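/- Fix a lattice step $\varepsilon>0$ and a mass $m>0$. A checker path is a finite sequence of points of the lattice $\varepsilon\mathbb Z^2$ such that the vector from each point (except the last one) to the next one equals $(\varepsilon,\varepsilon)$ or $(-\varepsilon,\varepsilon)$; $\mathrm{turns}(s)$ is the number of points of the path $s$, other than the first and the last one, at which the vectors to the next and to the previous point are orthogonal. For $(x,t)\in\varepsilon\mathbb Z^2$ with $t>0$ put $$a(x,t,m,\varepsilon)=(1+m^2\varepsilon^2)^{(1-t/\varepsilon)/2}\,i\sum_s(-im\varepsilon)^{\mathrm{turns}(s)},$$ where the sum is over all checker paths $s$ from $(0,0)$ to $(x,t)$ containing $(\varepsilon,\varepsilon)$, and let $\tilde a_1(x,t,m,\varepsilon)=\operatorname{Re}a(x,t+\varepsilon,m,\varepsilon)$, $\tilde a_1(x,t,m)=\tilde a_1(x,t,m,1)$. Let $w,d$ be real numbers (the dip width and depth exponents) and let $T$ be a positive integer. A point $v\in\left(-\frac1{\sqrt{1+m^2}},\frac1{\sqrt{1+m^2}}\right)$ is called a dip of order $T$ of $\tilde a_1(x,t,m)$ if for each integer sequence $x_t$ with $x_t=vt+o(t^w)$ as $t\to\infty$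 (over the integers) we have $$\tilde a_1(x_t,t,m)-\tilde a_1(x_t-2T,t,m)=o(t^d)\quad\text{as }t\to\infty.$$ A point $v\in\left(-\frac1{\sqrt{1+m^2\varepsilon^2}},\frac1{\sqrt{1+m^2\varepsilon^2}}\right)$ is called a dip of order $T$ of $\tilde a_1(x,t,m,\varepsilon)$ if it is a dip of order $T$ of $\tilde a_1(x,t,m\varepsilon)$. Theorem. Let $w=1/2$ and $d=-1/2$. If $m>0$ and $0<\varepsilon\le 1/m$, then for every positive integer $T$ the dips of order $T$ of $\tilde a_1(x,t,m,\varepsilon)$ are exactly the points $$v=\frac{\sin(\pi k/T)}{\sqrt{m^2\varepsilon^2+\sin^2(\pi k/T)}},\qquad k\in\mathbb Z\cap\left(-\frac T2,\frac T2\right).$$ -/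

import Mathlib

open Filter Asymptotics

namespace FeynmanCheckers

/-- The lattice `ε ℤ²`, as a set of points `(x, t)` of the plane. -/
def lattice (ε : ℝ) : Set (ℝ × ℝ) :=
  {p | ∃ i j : ℤ, p = ((i : ℝ) * ε, (j : ℝ) * ε)}

/-- The vector from `p` to `q` equals `(ε, ε)` or `(-ε, ε)`. -/
def IsStep (ε : ℝ) (p q : ℝ × ℝ) : Prop :=
  q - p = (ε, ε) ∨ q - p = (-ε, ε)

/-- A checker path: a finite sequence of lattice points, each consecutive pair being a step. -/
def IsCheckerPath (ε : ℝ) (s : List (ℝ × ℝ)) : Prop :=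
  (∀ p ∈ s, p ∈ lattice ε) ∧ s.IsChain (IsStep ε)

/-- The vectors from `q` to `r` and from `q` to `p` are orthogonal. -/
def IsTurn (p q r : ℝ × ℝ) : Prop :=
  (r - q).1 * (p - q).1 + (r - q).2 * (p - q).2 = 0

open Classical in
/-- The number of points of the sequence, other than the first and the last one, at which the
vectors to the next and to the previous point are orthogonal. -/
noncomputable def turns : List (ℝ × ℝ) → ℕ
  | p :: q :: r :: l => (if IsTurn p q r then 1 else 0) + turns (q :: r :: l)
  | _ => 0

/-- The checker paths from `(0, 0)` to `(x, t)` that contain `(ε, ε)`. -/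
def paths (x t ε : ℝ) : Set (List (ℝ × ℝ)) :=
  {s | IsCheckerPath ε s ∧ s.head? = some (0, 0) ∧ s.getLast? = some (x, t) ∧ (ε, ε) ∈ s}

/-- Chains of steps with given starting point and given length form a finite set. -/
theorem finite_chains (ε : ℝ) (n : ℕ) (p : ℝ × ℝ) :
    {s : List (ℝ × ℝ) | s.IsChain (IsStep ε) ∧ s.head? = some p ∧ s.length = n}.Finite := by
  induction n generalizing p with
  | zero =>
    refine (Set.finite_singleton ([] : List (ℝ × ℝ))).subset ?_
    rintro s ⟨-, -, h⟩
    simpa using h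
  | succ n ih =>
    refine ((((ih (p + (ε, ε))).union (ih (p + (-ε, ε)))).image (List.cons p)).union
      (Set.finite_singleton [p])).subset ?_
    rintro s ⟨hc, hh, hl⟩
    match s, hc, hh, hl with
    | [q], _, hh, _ =>
      right
      simpa using hh
    | q :: r :: l, hc, hh, hl =>
      left
      have hq : q = p := by simpa using hh
      subst hq
      rw [List.isChain_cons_cons] at hc
      refine ⟨r :: l, ?_, rfl⟩
      have hl' : (r :: l).length = n := by simpa using hl
      rcases hc.1 with h | h
      · left
        exact ⟨hc.2, by simp [← h], hl'⟩
      · right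
        exact ⟨hc.2, by simp [← h], hl'⟩

/-- Each step of a path increases the time by `ε`. -/
theorem length_of_chain (ε : ℝ) (s : List (ℝ × ℝ)) (p q : ℝ × ℝ)
    (hc : s.IsChain (IsStep ε)) (hh : s.head? = some p) (hl : s.getLast? = some q) :
    q.2 = p.2 + ((s.length : ℝ) - 1) * ε := by
  induction s generalizing p with
  | nil => simp at hh
  | cons a l ih =>
    have ha : a = p := by simpa using hh
    subst ha
    cases l with
    | nil =>
      have hq : a = q := by simpa using hl
      subst hq
      simp
    | cons b l =>
      rw [List.isChain_cons_cons] at hc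
      have h1 := ih b hc.2 rfl (by simpa [List.getLast?_cons_cons] using hl)
      have h2 : b.2 - a.2 = ε := by
        rcases hc.1 with h | h
        · exact congrArg Prod.snd h
        · exact congrArg Prod.snd h
      rw [h1]
      simp only [List.length_cons]
      push_cast
      linarith

/-- There are finitely many paths, so the sum in the wave function is a genuine finite sum. -/
theorem finite_paths (x t : ℝ) {ε : ℝ} (hε : 0 < ε) : (paths x t ε).Finite := by
  by_cases hne : (paths x t ε).Nonempty
  · obtain ⟨s₀, hs₀⟩ := hne
    refine (finite_chains ε s₀.length (0, 0)).subset ?_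
    rintro s ⟨hs, hh, hl, -⟩
    refine ⟨hs.2, hh, ?_⟩
    have h1 := length_of_chain ε s _ _ hs.2 hh hl
    have h2 := length_of_chain ε s₀ _ _ hs₀.1.2 hs₀.2.1 hs₀.2.2.1
    have h3 : ((s.length : ℝ) - 1) * ε = ((s₀.length : ℝ) - 1) * ε := by linarith
    have h4 := mul_right_cancel₀ hε.ne' h3
    have h5 : (s.length : ℝ) = s₀.length := by linarith
    exact_mod_cast h5
  · rw [Set.not_nonempty_iff_eq_empty.mp hne]
    exact Set.finite_empty

/-- The wave function `a(x, t, m, ε)`. -/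
noncomputable def a (x t m ε : ℝ) : ℂ :=
  (((1 + m ^ 2 * ε ^ 2) ^ ((1 - t / ε) / 2) : ℝ) : ℂ) * Complex.I *
    ∑ᶠ s ∈ paths x t ε, (-Complex.I * (m : ℂ) * (ε : ℂ)) ^ turns s

/-- `ã₁(x, t, m, ε) = Re a(x, t + ε, m, ε)`. -/
noncomputable def a₁ (x t m ε : ℝ) : ℝ :=
  (a x (t + ε) m ε).re

/-- `v` is a dip of order `T` of `ã₁(x, t, m) = ã₁(x, t, m, 1)`, for the dip width exponent `w`
and the dip depth exponent `d`. -/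
def IsDipUnit (w d m : ℝ) (T : ℕ) (v : ℝ) : Prop :=
  v ∈ Set.Ioo (-(1 / √(1 + m ^ 2))) (1 / √(1 + m ^ 2)) ∧
    ∀ x : ℕ → ℤ,
      ((fun t : ℕ => (x t : ℝ) - v * (t : ℝ)) =o[atTop] fun t : ℕ => (t : ℝ) ^ w) →
      ((fun t : ℕ => a₁ (x t : ℝ) (t : ℝ) m 1 - a₁ ((x t : ℝ) - 2 * (T : ℝ)) (t : ℝ) m 1)
        =o[atTop] fun t : ℕ => (t : ℝ) ^ d)

/-- `v` is a dip of order `T` of `ã₁(x, t, m, ε)`: by definition, a dip of order `T` of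
`ã₁(x, t, m ε)`. -/
def IsDip (w d m ε : ℝ) (T : ℕ) (v : ℝ) : Prop :=
  IsDipUnit w d (m * ε) T v

end FeynmanCheckers

/-! Splitting paths at the first step shows that `a₁` solves a discrete Klein–Gordon equation. Two
initial values determine the solution, so at points of the right parity (`x + t` odd) it is `m / π`
times the integral of `sin (t ω(p) - p x) / S(p)` over `[-π/2, π/2]`, with `cos ω = cos p / √(1 +
m²)` and `S = √(m² + sin² p)` (`a₁_eq_wave`). Near `x = v t` the phase is `t ψ`, where `ψ(p) = ω(p)
- v p` has a single stationary point `q`, given by `sin q = v S(q)`. Only a neighbourhood of `q`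
contributes at order `t^{-1/2}`, and a shift of `x` by `2T` multiplies this contribution by
`e^{2iTq}`. A dip therefore means `e^{2iTq} = 1`, i.e. `q = π k / T`, and then `v = sin q / S(q)`.

If `e^{2iTq} = 1`, the amplitude of the difference is divisible by `ψ'`. One integration by parts
gives `O((1 + |x - v t|) / t)`, which is `o(t^{-1/2})` when `x - v t = o(√t)`
(`isLittleO_of_planeWave_eq_one`).

Conversely, along points within bounded distance of `v t`, the difference is `O(1/t)` plus a nonzero
multiple of the imaginary part of a rotated copy of `(1 - e^{2iTq}) J(t)`, where `J(t)` is the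
integral of `e^{itψ} / S`. Two sequences of points give two independent rotations, so a dip with
`e^{2iTq} ≠ 1` would force `J(t) = o(t^{-1/2})`. No stationary phase expansion is needed to refute
this: a mean-square estimate suffices (`not_isLittleO_oscInt_one`). -/

namespace FeynmanCheckers

open scoped Real Interval ComplexConjugate

/-! ### Checker paths and the discrete Klein–Gordon equation -/

/-- The direction of a step, as an integer. -/
def dir (b : Bool) : ℤ := if b then 1 else -1

/-- The step of the unit lattice in a given direction. -/
def unitStep (b : Bool) : ℝ × ℝ := ((dir b : ℤ), 1)

/-- Paths of `n + 1` steps from `p` to `q` whose first step has direction `b`. -/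
def pathsFrom (b : Bool) (n : ℕ) (p q : ℝ × ℝ) : Set (List (ℝ × ℝ)) :=
  {s | s.IsChain (IsStep 1) ∧ s.getLast? = some q ∧
    ∃ l, s = p :: (p + unitStep b) :: l ∧ l.length = n}

/-- The sum of `c ^ turns` over paths of `n + 1` steps with displacement `x`
and first step in direction `b`. -/
def amplitude (c : ℂ) : ℕ → Bool → ℤ → ℂ
  | 0, b, x => if x = dir b then 1 else 0
  | n + 1, b, x => amplitude c n b (x - dir b) + c * amplitude c n (!b) (x - dir b)

theorem isStep_one_iff (p q : ℝ × ℝ) : IsStep 1 p q ↔ ∃ b, q = p + unitStep b := by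
  simp only [IsStep, unitStep, dir, Bool.exists_bool, sub_eq_iff_eq_add']
  simp [or_comm]

theorem isTurn_unitStep (p : ℝ × ℝ) (b b' : Bool) :
    IsTurn p (p + unitStep b) (p + unitStep b + unitStep b') ↔ b' = !b := by
  cases b <;> cases b' <;> simp [IsTurn, unitStep, dir]

theorem unitStep_injective : Function.Injective unitStep := by
  intro b b' h
  have := congrArg Prod.fst h
  cases b <;> cases b' <;> simp [unitStep, dir] at this ⊢ <;> norm_num at this

theorem finite_pathsFrom (b : Bool) (n : ℕ) (p q : ℝ × ℝ) : (pathsFrom b n p q).Finite := by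
  refine (finite_chains 1 (n + 2) p).subset ?_
  rintro s ⟨hc, -, l, rfl, hl⟩
  exact ⟨hc, rfl, by simp [hl]⟩

theorem pathsFrom_succ (b : Bool) (n : ℕ) (p q : ℝ × ℝ) :
    pathsFrom b (n + 1) p q =
      List.cons p '' (pathsFrom b n (p + unitStep b) q ∪ pathsFrom (!b) n (p + unitStep b) q) := by
  ext s
  constructor
  · rintro ⟨hc, hq, l, rfl, hl⟩
    cases l with
    | nil => simp at hl
    | cons r l =>
      rw [List.isChain_cons_cons] at hc
      have h1 := hc.2
      rw [List.isChain_cons_cons] at h1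
      obtain ⟨b', rfl⟩ := (isStep_one_iff _ _).1 h1.1
      have key : (p + unitStep b) :: (p + unitStep b + unitStep b') :: l
          ∈ pathsFrom b' n (p + unitStep b) q :=
        ⟨hc.2, by simpa [List.getLast?_cons_cons] using hq, l, rfl, by simpa using hl⟩
      refine ⟨_, ?_, rfl⟩
      by_cases h : b' = b
      · left; rwa [h] at key ⊢
      · right
        have : b' = !b := by cases b <;> cases b' <;> simp_all
        rwa [this] at key ⊢
  · rintro ⟨s', hs', rfl⟩
    obtain ⟨b', hc, hq, l, rfl, hl⟩ : ∃ b', s' ∈ pathsFrom b' n (p + unitStep b) q := by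
      rcases hs' with h | h
      · exact ⟨_, h⟩
      · exact ⟨_, h⟩
    refine ⟨?_, by simpa [List.getLast?_cons_cons] using hq, _, rfl, by simpa using hl⟩
    rw [List.isChain_cons_cons]
    exact ⟨(isStep_one_iff _ _).2 ⟨b, rfl⟩, hc⟩

theorem disjoint_pathsFrom (b : Bool) (n : ℕ) (p q : ℝ × ℝ) :
    Disjoint (pathsFrom b n p q) (pathsFrom (!b) n p q) := by
  rw [Set.disjoint_left]
  rintro s ⟨-, -, l, rfl, -⟩ ⟨-, -, l', h, -⟩
  have h2 : p + unitStep b = p + unitStep (!b) := by simp at h; simp [h.1]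
  have := unitStep_injective (add_left_cancel h2)
  cases b <;> simp at this

theorem turns_cons (c : ℂ) (b b' : Bool) (n : ℕ) (p q : ℝ × ℝ) (s : List (ℝ × ℝ))
    (hs : s ∈ pathsFrom b' n (p + unitStep b) q) :
    c ^ turns (p :: s) = (if b' = !b then c else 1) * c ^ turns s := by
  obtain ⟨-, -, l, rfl, -⟩ := hs
  rw [turns]
  simp only [isTurn_unitStep]
  split_ifs <;> simp [pow_add]

/-- Removing the first point leaves a path whose first direction either repeats `b` or reverses it;
the second case costs one turn. The starting point is arbitrary because the induction moves it. -/
theorem finsum_pathsFrom (c : ℂ) (n : ℕ) (b : Bool) (p : ℝ × ℝ) (x : ℤ) :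
    ∑ᶠ s ∈ pathsFrom b n p (p + ((x : ℝ), (n : ℝ) + 1)), c ^ turns s = amplitude c n b x := by
  induction n generalizing b p x with
  | zero =>
    rw [amplitude]
    split_ifs with h
    · have : pathsFrom b 0 p (p + ((x : ℝ), ((0 : ℕ) : ℝ) + 1)) = {[p, p + unitStep b]} := by
        ext s
        constructor
        · rintro ⟨-, -, l, rfl, hl⟩
          simp [List.length_eq_zero_iff.1 hl]
        · rintro rfl
          refine ⟨?_, ?_, [], rfl, rfl⟩
          · simpa using (isStep_one_iff _ _).2 ⟨b, rfl⟩
          · simp [unitStep, h]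
      rw [this, finsum_mem_singleton]
      simp [turns]
    · have : pathsFrom b 0 p (p + ((x : ℝ), ((0 : ℕ) : ℝ) + 1)) = ∅ := by
        rw [Set.eq_empty_iff_forall_notMem]
        rintro s ⟨-, hq, l, rfl, hl⟩
        rw [List.length_eq_zero_iff.1 hl] at hq
        simp [unitStep] at hq
        exact h hq.symm
      rw [this, finsum_mem_empty]
  | succ n ih =>
    have hq : p + ((x : ℝ), ((n + 1 : ℕ) : ℝ) + 1)
        = (p + unitStep b) + (((x - dir b : ℤ) : ℝ), (n : ℝ) + 1) := by
      ext <;> simp [unitStep] ; ring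
    rw [hq, pathsFrom_succ, finsum_mem_image (List.cons_injective.injOn),
      finsum_mem_union (disjoint_pathsFrom _ _ _ _) (finite_pathsFrom _ _ _ _)
        (finite_pathsFrom _ _ _ _), amplitude]
    congr 1
    · rw [← ih b (p + unitStep b)]
      refine finsum_mem_congr rfl fun s hs => ?_
      rw [turns_cons c b b n p _ s hs]
      simp
    · rw [← ih (!b) (p + unitStep b), mul_finsum_mem]
      refine finsum_mem_congr rfl fun s hs => ?_
      rw [turns_cons c b (!b) n p _ s hs]
      simp

theorem add_one_le_of_mem_chain (p q : ℝ × ℝ) (l : List (ℝ × ℝ))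
    (hc : (p :: l).IsChain (IsStep 1)) (hq : q ∈ l) : p.2 + 1 ≤ q.2 := by
  induction l generalizing p with
  | nil => simp at hq
  | cons r l ih =>
    rw [List.isChain_cons_cons] at hc
    obtain ⟨b, rfl⟩ := (isStep_one_iff _ _).1 hc.1
    rcases List.mem_cons.1 hq with rfl | h
    · simp [unitStep]
    · have := ih _ hc.2 h
      simp [unitStep] at this
      linarith

theorem mem_lattice_of_mem_chain (p q : ℝ × ℝ) (l : List (ℝ × ℝ)) (hp : p ∈ lattice 1)
    (hc : (p :: l).IsChain (IsStep 1)) (hq : q ∈ p :: l) : q ∈ lattice 1 := by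
  induction l generalizing p with
  | nil => rw [List.mem_singleton] at hq; rwa [hq]
  | cons r l ih =>
    rcases List.mem_cons.1 hq with rfl | h
    · exact hp
    · rw [List.isChain_cons_cons] at hc
      refine ih r ?_ hc.2 h
      obtain ⟨b, rfl⟩ := (isStep_one_iff _ _).1 hc.1
      obtain ⟨i, j, rfl⟩ := hp
      exact ⟨i + dir b, j + 1, by simp [unitStep]⟩

/-- Time grows by 1 at each step, so `(1, 1)` can only be the second point of the path: containing
it means that the first step goes right. -/
theorem paths_eq_pathsFrom (x : ℝ) (t : ℕ) :
    paths x ((t : ℝ) + 1) 1 = pathsFrom true t (0, 0) (x, (t : ℝ) + 1) := by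
  have hstep : ((0, 0) : ℝ × ℝ) + unitStep true = (1, 1) := by simp [unitStep, dir]
  ext s
  constructor
  · rintro ⟨⟨-, hc⟩, hh, hl, hmem⟩
    refine ⟨hc, hl, ?_⟩
    have hlen := length_of_chain 1 s _ _ hc hh hl
    have hlen' : s.length = t + 2 := by
      have : (s.length : ℝ) = t + 2 := by simp at hlen; linarith
      exact_mod_cast this
    match s, hc, hh, hl, hmem, hlen' with
    | p :: r :: l, hc, hh, hl, hmem, hlen' =>
      obtain rfl : p = (0, 0) := by simpa using hh
      refine ⟨l, ?_, by simpa using hlen'⟩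
      rw [List.isChain_cons_cons] at hc
      rw [hstep]
      rcases List.mem_cons.1 hmem with h | h
      · simp at h
      rcases List.mem_cons.1 h with h' | h'
      · rw [h']
      · obtain ⟨b, rfl⟩ := (isStep_one_iff _ _).1 hc.1
        have := add_one_le_of_mem_chain _ _ _ hc.2 h'
        simp [unitStep] at this
        norm_num at this
  · rintro ⟨hc, hl, l, rfl, -⟩
    refine ⟨⟨fun p hp => mem_lattice_of_mem_chain _ _ _ ⟨0, 0, by simp⟩ hc hp, hc⟩, rfl, hl, ?_⟩
    rw [hstep]
    simp

theorem a₁_eq_amplitude (m : ℝ) (x : ℤ) (t : ℕ) :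
    a₁ x t m 1 = (((1 + m ^ 2) ^ (-(t : ℝ) / 2) : ℝ)) *
      (Complex.I * amplitude (-Complex.I * m) t true x).re := by
  rw [a₁, a, paths_eq_pathsFrom, ← finsum_pathsFrom _ _ _ (0, 0)]
  have h : ((0, 0) : ℝ × ℝ) + ((x : ℝ), (t : ℝ) + 1) = ((x : ℝ), (t : ℝ) + 1) := by simp
  rw [h, mul_assoc, Complex.re_ofReal_mul]
  simp only [Complex.ofReal_one, mul_one, one_pow, div_one]
  congr 2
  ring

/-- The left-moving amplitude is eliminated between two first-step relations. For `c = -im` the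
coefficient `1 - c²` is `1 + m²`. -/
theorem amplitude_add_two (c : ℂ) (n : ℕ) (x : ℤ) :
    amplitude c (n + 2) true x = amplitude c (n + 1) true (x - 1) +
      amplitude c (n + 1) true (x + 1) - (1 - c ^ 2) * amplitude c n true x := by
  have h1 : amplitude c (n + 2) true x = amplitude c (n + 1) true (x - 1) +
      c * amplitude c (n + 1) false (x - 1) := rfl
  have h2 : amplitude c (n + 1) false (x - 1) = amplitude c n false x +
      c * amplitude c n true x := by
    simp [amplitude, dir]
  have h3 : amplitude c (n + 1) true (x + 1) = amplitude c n true x +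
      c * amplitude c n false x := by
    simp [amplitude, dir]
  rw [h1, h2, h3]
  ring

theorem a₁_zero (m : ℝ) (x : ℤ) : a₁ x 0 m 1 = 0 := by
  have := a₁_eq_amplitude m x 0
  rw [Nat.cast_zero] at this
  rw [this, amplitude]
  split_ifs <;> simp

theorem a₁_one (m : ℝ) (x : ℤ) : a₁ x 1 m 1 = if x = 0 then m / √(1 + m ^ 2) else 0 := by
  have := a₁_eq_amplitude m x 1
  rw [Nat.cast_one] at this
  have hN : (0 : ℝ) ≤ 1 + m ^ 2 := by positivity
  have h2 : ((1 + m ^ 2) ^ (-(1 : ℝ) / 2) : ℝ) = (√(1 + m ^ 2))⁻¹ := by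
    rw [Real.sqrt_eq_rpow, ← Real.rpow_neg hN]; norm_num
  rw [this, h2]
  simp only [amplitude, dir]
  by_cases h : x = 0
  · simp [h]; ring
  · have h' : ¬ (x - 1 = -1) := by omega
    simp [h, h']
    right
    split_ifs <;> simp

theorem a₁_add_two (m : ℝ) (x : ℤ) (t : ℕ) :
    √(1 + m ^ 2) * a₁ x (t + 2 : ℕ) m 1 = a₁ (x - 1 : ℤ) (t + 1 : ℕ) m 1 +
      a₁ (x + 1 : ℤ) (t + 1 : ℕ) m 1 - √(1 + m ^ 2) * a₁ x t m 1 := by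
  have hN : (0 : ℝ) < 1 + m ^ 2 := by positivity
  have e1 : √(1 + m ^ 2) * (1 + m ^ 2) ^ (-((t + 2 : ℕ) : ℝ) / 2) =
      (1 + m ^ 2) ^ (-((t + 1 : ℕ) : ℝ) / 2) := by
    rw [Real.sqrt_eq_rpow, ← Real.rpow_add hN]; congr 1; push_cast; ring
  have e2 : √(1 + m ^ 2) * (1 + m ^ 2) ^ (-(t : ℝ) / 2) =
      (1 + m ^ 2) * (1 + m ^ 2) ^ (-((t + 1 : ℕ) : ℝ) / 2) := by
    nth_rewrite 3 [← Real.rpow_one (1 + m ^ 2)]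
    rw [Real.sqrt_eq_rpow, ← Real.rpow_add hN, ← Real.rpow_add hN]; congr 1; push_cast; ring
  rw [a₁_eq_amplitude, a₁_eq_amplitude, a₁_eq_amplitude, a₁_eq_amplitude, ← mul_assoc, e1,
    ← mul_assoc, e2, amplitude_add_two]
  have e3 : 1 - (-Complex.I * (m : ℂ)) ^ 2 = ((1 + m ^ 2 : ℝ) : ℂ) := by
    rw [mul_pow, neg_sq, Complex.I_sq]; push_cast; ring
  rw [e3, mul_sub, mul_add, mul_left_comm, Complex.sub_re, Complex.add_re, Complex.re_ofReal_mul]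
  ring

/-! ### Dispersion relation and Fourier representation -/

/-- The density `√(m² + sin² p)`. -/
noncomputable def density (m p : ℝ) : ℝ := √(m ^ 2 + Real.sin p ^ 2)

/-- The frequency `arccos (cos p / √(1 + m²))`. -/
noncomputable def freq (m p : ℝ) : ℝ := Real.arccos (Real.cos p / √(1 + m ^ 2))

theorem density_pos {m : ℝ} (hm : 0 < m) (p : ℝ) : 0 < density m p :=
  Real.sqrt_pos.2 (by positivity)

theorem density_sq (m p : ℝ) : density m p ^ 2 = m ^ 2 + Real.sin p ^ 2 :=
  Real.sq_sqrt (by positivity)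

theorem abs_sin_lt_density {m : ℝ} (hm : 0 < m) (p : ℝ) : |Real.sin p| < density m p := by
  rw [density, ← Real.sqrt_sq_eq_abs]
  exact Real.sqrt_lt_sqrt (sq_nonneg _) (by nlinarith [pow_pos hm 2])

theorem density_le (m p : ℝ) : density m p ≤ √(1 + m ^ 2) :=
  Real.sqrt_le_sqrt (by nlinarith [Real.sin_sq_le_one p])

theorem density_neg (m p : ℝ) : density m (-p) = density m p := by
  simp [density]

theorem freq_neg (m p : ℝ) : freq m (-p) = freq m p := by
  simp [freq]

theorem contDiff_density {m : ℝ} (hm : 0 < m) : ContDiff ℝ 1 (density m) :=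
  ContDiff.sqrt (by fun_prop) fun p => by positivity

theorem sqrt_one_add_sq_pos (m : ℝ) : 0 < √(1 + m ^ 2) := Real.sqrt_pos.2 (by positivity)

theorem one_lt_sqrt_one_add_sq {m : ℝ} (hm : 0 < m) : 1 < √(1 + m ^ 2) :=
  Real.lt_sqrt_of_sq_lt (by nlinarith [pow_pos hm 2])

theorem abs_cos_div_lt_one {m : ℝ} (hm : 0 < m) (p : ℝ) :
    |Real.cos p / √(1 + m ^ 2)| < 1 := by
  rw [abs_div, abs_of_pos (sqrt_one_add_sq_pos m), div_lt_one (sqrt_one_add_sq_pos m)]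
  exact (Real.abs_cos_le_one p).trans_lt (one_lt_sqrt_one_add_sq hm)

theorem cos_freq {m : ℝ} (hm : 0 < m) (p : ℝ) :
    Real.cos (freq m p) = Real.cos p / √(1 + m ^ 2) := by
  have := abs_lt.1 (abs_cos_div_lt_one hm p)
  exact Real.cos_arccos this.1.le this.2.le

theorem sqrt_one_sub_cos_div_sq (m p : ℝ) :
    √(1 - (Real.cos p / √(1 + m ^ 2)) ^ 2) = density m p / √(1 + m ^ 2) := by
  rw [density, ← Real.sqrt_div (by positivity)]
  congr 1
  rw [div_pow, Real.sq_sqrt (by positivity), Real.cos_sq']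
  field_simp
  ring

theorem sin_freq (m p : ℝ) : Real.sin (freq m p) = density m p / √(1 + m ^ 2) := by
  rw [freq, Real.sin_arccos, sqrt_one_sub_cos_div_sq]

theorem hasDerivAt_freq {m : ℝ} (hm : 0 < m) (p : ℝ) :
    HasDerivAt (freq m) (Real.sin p / density m p) p := by
  have h := abs_lt.1 (abs_cos_div_lt_one hm p)
  have h1 := (Real.hasDerivAt_arccos h.1.ne' h.2.ne).comp p
    ((Real.hasDerivAt_cos p).div_const (√(1 + m ^ 2)))
  convert! h1 using 1
  rw [sqrt_one_sub_cos_div_sq]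
  have := density_pos hm p
  have := sqrt_one_add_sq_pos m
  field_simp

theorem continuous_freq {m : ℝ} : Continuous (freq m) :=
  Real.continuous_arccos.comp (by fun_prop)

theorem continuous_density {m : ℝ} : Continuous (density m) := by
  unfold density; fun_prop

/-- The oscillatory integral whose imaginary part represents the wave function. -/
noncomputable def wave (m : ℝ) (x : ℤ) (t : ℕ) : ℝ :=
  ∫ p in (-(π / 2))..(π / 2), Real.sin (t * freq m p - p * x) / density m p

theorem continuous_wave_integrand {m : ℝ} (hm : 0 < m) (x : ℤ) (t : ℕ) :
    Continuous fun p : ℝ => Real.sin (t * freq m p - p * x) / density m p :=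
  Continuous.div (by have := continuous_freq (m := m); fun_prop) continuous_density
    fun p => (density_pos hm p).ne'

/-- The equation holds already for the integrands: the sum-to-product formulas reduce it to the
dispersion relation `√(1 + m²) cos ω = cos p`. -/
theorem wave_add_two {m : ℝ} (hm : 0 < m) (x : ℤ) (t : ℕ) :
    √(1 + m ^ 2) * wave m x (t + 2) = wave m (x - 1) (t + 1) + wave m (x + 1) (t + 1) -
      √(1 + m ^ 2) * wave m x t := by
  have hi := fun (x : ℤ) (t : ℕ) =>
    (continuous_wave_integrand hm x t).intervalIntegrable (μ := MeasureTheory.volume)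
      (-(π / 2)) (π / 2)
  simp only [wave]
  rw [← intervalIntegral.integral_const_mul, ← intervalIntegral.integral_const_mul,
    ← intervalIntegral.integral_add (hi _ _) (hi _ _),
    ← intervalIntegral.integral_sub ((hi _ _).add (hi _ _)) ((hi _ _).const_mul _)]
  congr 1
  ext p
  have hN := sqrt_one_add_sq_pos m
  have hd := density_pos hm p
  have hc : √(1 + m ^ 2) * Real.cos (freq m p) = Real.cos p := by
    rw [cos_freq hm]; field_simp
  generalize freq m p = w at hc ⊢
  obtain ⟨u, hu⟩ : ∃ u, u = ((t : ℝ) + 1) * w - p * x := ⟨_, rfl⟩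
  have e1 : ((t + 2 : ℕ) : ℝ) * w - p * x = u + w := by rw [hu]; push_cast; ring
  have e2 : (t : ℝ) * w - p * x = u - w := by rw [hu]; ring
  have e3 : ((t + 1 : ℕ) : ℝ) * w - p * (x - 1 : ℤ) = u + p := by rw [hu]; push_cast; ring
  have e4 : ((t + 1 : ℕ) : ℝ) * w - p * (x + 1 : ℤ) = u - p := by rw [hu]; push_cast; ring
  rw [e1, e2, e3, e4, Real.sin_add, Real.sin_sub, Real.sin_add, Real.sin_sub]
  field_simp
  linear_combination 2 * Real.sin u * hc

theorem integral_eq_zero_of_odd (f : ℝ → ℝ) (hf : ∀ p, f (-p) = -f p) (b : ℝ) :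
    ∫ p in (-b)..b, f p = 0 := by
  have h := intervalIntegral.integral_comp_neg (a := -b) (b := b) f
  simp only [hf, intervalIntegral.integral_neg, neg_neg] at h
  linarith

theorem wave_zero (m : ℝ) (x : ℤ) : wave m x 0 = 0 :=
  integral_eq_zero_of_odd _ (fun p => by simp [density_neg, neg_div]) _

theorem integral_cos_mul_int (x : ℤ) (hx : Even x) :
    ∫ p in (-(π / 2))..(π / 2), Real.cos (p * x) = if x = 0 then π else 0 := by
  split_ifs with h
  · simp [h]
  · have hx0 : (x : ℝ) ≠ 0 := by exact_mod_cast h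
    rw [intervalIntegral.integral_comp_mul_right _ hx0, integral_cos]
    obtain ⟨k, rfl⟩ := hx
    have e1 : π / 2 * ((k + k : ℤ) : ℝ) = k * π := by push_cast; ring
    have e2 : -(π / 2) * ((k + k : ℤ) : ℝ) = -(k * π) := by push_cast; ring
    rw [e1, e2, Real.sin_neg, Real.sin_int_mul_pi]
    simp

/-- The density is chosen so that `sin ω / S` is constant. The other term of the sine expansion is
odd in `p`, and for even `x` the integral of `cos (p x)` over half a period vanishes unless `x = 0`.
-/
theorem wave_one {m : ℝ} (hm : 0 < m) (x : ℤ) (hx : Even x) :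
    wave m x 1 = if x = 0 then π / √(1 + m ^ 2) else 0 := by
  have hN := sqrt_one_add_sq_pos m
  have hf := continuous_freq (m := m)
  have h1 : ∀ p, Real.sin ((1 : ℕ) * freq m p - p * x) / density m p =
      Real.cos (p * x) / √(1 + m ^ 2) -
        Real.cos (freq m p) * Real.sin (p * x) / density m p := by
    intro p
    have hd := density_pos hm p
    rw [Nat.cast_one, one_mul, Real.sin_sub, sin_freq]
    field_simp
  have hodd := integral_eq_zero_of_odd
    (fun p => Real.cos (freq m p) * Real.sin (p * x) / density m p)
    (fun p => by simp only [freq_neg, density_neg, neg_mul, Real.sin_neg]; ring) (π / 2)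
  rw [wave]
  simp only [h1]
  rw [intervalIntegral.integral_sub, hodd, intervalIntegral.integral_div,
    integral_cos_mul_int x hx]
  · split_ifs <;> simp
  · exact Continuous.intervalIntegrable (by fun_prop) _ _
  · exact (Continuous.div (by fun_prop) continuous_density
      fun p => (density_pos hm p).ne').intervalIntegrable _ _

/-- Both sides satisfy the same second-order recursion in `t` and agree at `t = 0, 1`. The parity
factor is constant along the recursion; it removes points that no path reaches, where the
half-period integral need not vanish. -/
theorem a₁_eq_wave {m : ℝ} (hm : 0 < m) (t : ℕ) (x : ℤ) :
    a₁ x t m 1 = (1 - (x + t).negOnePow : ℝ) * (m / (2 * π)) * wave m x t := by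
  have hN := sqrt_one_add_sq_pos m
  induction t using Nat.twoStepInduction generalizing x with
  | zero => rw [Nat.cast_zero, a₁_zero, wave_zero, mul_zero]
  | one =>
    rw [Nat.cast_one, a₁_one]
    rcases Int.even_or_odd x with h | h
    · rw [wave_one hm x h, Nat.cast_one, Int.negOnePow_odd _ (by simpa using h.add_odd odd_one)]
      split_ifs
      · have := Real.pi_pos
        push_cast
        field_simp
        norm_num
      · simp
    · rw [Nat.cast_one, Int.negOnePow_even _ (by simpa using h.add_odd odd_one), if_neg]
      · simp
      · rintro rfl
        simp at h
  | more t ih1 ih2 =>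
    have h1 := a₁_add_two m x t
    have h2 := wave_add_two hm x t
    rw [ih1, ih2, ih2] at h1
    have e1 : (x - 1 + (t + 1 : ℕ)).negOnePow = (x + t).negOnePow := by
      congr 1; push_cast; ring
    have e2 : (x + 1 + (t + 1 : ℕ)).negOnePow = (x + t).negOnePow := by
      have : x + 1 + ((t + 1 : ℕ) : ℤ) = x + t + 2 := by push_cast; ring
      rw [this, Int.negOnePow_add, Int.negOnePow_even 2 even_two, mul_one]
    have e3 : (x + (t + 2 : ℕ)).negOnePow = (x + t).negOnePow := by
      have : x + ((t + 2 : ℕ) : ℤ) = x + t + 2 := by push_cast; ring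
      rw [this, Int.negOnePow_add, Int.negOnePow_even 2 even_two, mul_one]
    rw [e1, e2] at h1
    rw [e3]
    apply mul_left_cancel₀ hN.ne'
    rw [h1]
    linear_combination -(1 - ((x + t).negOnePow : ℝ)) * (m / (2 * π)) * h2

/-! ### Integration by parts in oscillatory integrals -/

theorem continuousAt_deriv_of_contDiffAt {f : ℝ → ℂ} {p : ℝ} (hf : ContDiffAt ℝ 1 f p) :
    ContinuousAt (deriv f) p :=
  (hf.continuousAt_fderiv one_ne_zero).clm_apply continuousAt_const

/-- A `C¹` function and its derivative are bounded on a compact interval. -/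
theorem exists_bound_deriv {f : ℝ → ℂ} {a b : ℝ} (hf : ∀ p ∈ Set.Icc a b, ContDiffAt ℝ 1 f p) :
    ∃ M, 0 ≤ M ∧ ∀ p ∈ Set.Icc a b, ‖f p‖ ≤ M ∧ ‖deriv f p‖ ≤ M := by
  have h1 : ContinuousOn f (Set.Icc a b) := fun p hp => (hf p hp).continuousAt.continuousWithinAt
  have h2 : ContinuousOn (deriv f) (Set.Icc a b) := fun p hp =>
    (continuousAt_deriv_of_contDiffAt (hf p hp)).continuousWithinAt
  obtain ⟨M₁, hM₁⟩ := isCompact_Icc.exists_bound_of_continuousOn h1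
  obtain ⟨M₂, hM₂⟩ := isCompact_Icc.exists_bound_of_continuousOn h2
  exact ⟨|M₁| + |M₂|, by positivity, fun p hp =>
    ⟨by linarith [hM₁ p hp, le_abs_self M₁, abs_nonneg M₂],
      by linarith [hM₂ p hp, le_abs_self M₂, abs_nonneg M₁]⟩⟩

theorem norm_exp_I_mul (x : ℝ) : ‖Complex.exp (Complex.I * x)‖ = 1 := by
  rw [mul_comm, Complex.norm_exp_ofReal_mul_I]

/-- An oscillatory integral whose amplitude is divisible by the derivative of the phase decays
at rate `1 / t`. -/
theorem norm_integral_deriv_mul_exp_le {ψ ψ' : ℝ → ℝ} {G : ℝ → ℂ} {a b M t : ℝ} (hab : a ≤ b)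
    (hψ : ∀ p, HasDerivAt ψ (ψ' p) p) (hψ' : Continuous ψ')
    (hG : ∀ p ∈ Set.Icc a b, ContDiffAt ℝ 1 G p)
    (hM : ∀ p ∈ Set.Icc a b, ‖G p‖ ≤ M) (hM' : ∀ p ∈ Set.Icc a b, ‖deriv G p‖ ≤ M)
    (ht : 0 < t) :
    ‖∫ p in a..b, (ψ' p : ℂ) * G p * Complex.exp (Complex.I * (t * ψ p : ℝ))‖ ≤
      (2 + (b - a)) * M / t := by
  have hcψ : Continuous ψ := continuous_iff_continuousAt.2 fun p => (hψ p).continuousAt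
  have hcG : ContinuousOn G (Set.uIcc a b) := by
    rw [Set.uIcc_of_le hab]
    exact fun p hp => (hG p hp).continuousAt.continuousWithinAt
  have hcG' : ContinuousOn (deriv G) (Set.uIcc a b) := by
    rw [Set.uIcc_of_le hab]
    exact fun p hp => (continuousAt_deriv_of_contDiffAt (hG p hp)).continuousWithinAt
  have hce : Continuous fun p => Complex.exp (Complex.I * (t * ψ p : ℝ)) := by fun_prop
  have hi1 : IntervalIntegrable (fun p => deriv G p * Complex.exp (Complex.I * (t * ψ p : ℝ)))
      MeasureTheory.volume a b := (hcG'.mul hce.continuousOn).intervalIntegrable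
  have hi2 : IntervalIntegrable
      (fun p => (ψ' p : ℂ) * G p * Complex.exp (Complex.I * (t * ψ p : ℝ)))
      MeasureTheory.volume a b :=
    (((by fun_prop : Continuous fun p => (ψ' p : ℂ)).continuousOn.mul hcG).mul
      hce.continuousOn).intervalIntegrable
  have hder : ∀ p ∈ Set.uIcc a b,
      HasDerivAt (fun p => G p * Complex.exp (Complex.I * (t * ψ p : ℝ)))
        (deriv G p * Complex.exp (Complex.I * (t * ψ p : ℝ)) + Complex.I * t *
          ((ψ' p : ℂ) * G p * Complex.exp (Complex.I * (t * ψ p : ℝ)))) p := by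
    intro p hp
    rw [Set.uIcc_of_le hab] at hp
    have h1 := ((hG p hp).differentiableAt one_ne_zero).hasDerivAt
    have h2 := ((((hψ p).const_mul t).ofReal_comp).const_mul Complex.I).cexp
    convert! h1.mul h2 using 1
    push_cast
    ring
  -- Integration by parts. The two endpoint terms and the integral of `G'` account for the constant
  -- `(2 + (b - a)) * M`.
  have key := intervalIntegral.integral_eq_sub_of_hasDerivAt hder
    (hi1.add (hi2.const_mul (Complex.I * t)))
  rw [intervalIntegral.integral_add hi1 (hi2.const_mul _),
    intervalIntegral.integral_const_mul] at key
  have hb : ‖∫ p in a..b, deriv G p * Complex.exp (Complex.I * (t * ψ p : ℝ))‖ ≤ M * |b - a| := by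
    refine intervalIntegral.norm_integral_le_of_norm_le_const fun p hp => ?_
    rw [Set.uIoc_of_le hab] at hp
    rw [norm_mul, norm_exp_I_mul, mul_one]
    exact hM' p (Set.Ioc_subset_Icc_self hp)
  rw [abs_of_nonneg (sub_nonneg.2 hab)] at hb
  have ha' : ‖G a * Complex.exp (Complex.I * (t * ψ a : ℝ))‖ ≤ M := by
    rw [norm_mul, norm_exp_I_mul, mul_one]; exact hM a (Set.left_mem_Icc.2 hab)
  have hb' : ‖G b * Complex.exp (Complex.I * (t * ψ b : ℝ))‖ ≤ M := by
    rw [norm_mul, norm_exp_I_mul, mul_one]; exact hM b (Set.right_mem_Icc.2 hab)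
  rw [le_div_iff₀ ht]
  have hn := congrArg norm (eq_sub_of_add_eq' key)
  rw [norm_mul, norm_mul, Complex.norm_I, one_mul, Complex.norm_real, Real.norm_of_nonneg ht.le]
    at hn
  rw [mul_comm, hn]
  refine (norm_sub_le _ _).trans ?_
  have := norm_sub_le (G b * Complex.exp (Complex.I * (t * ψ b : ℝ)))
    (G a * Complex.exp (Complex.I * (t * ψ a : ℝ)))
  linarith

/-! ### The phase and its stationary point -/

/-- The phase `ω(p) - v p`. -/
noncomputable def phase (m v p : ℝ) : ℝ := freq m p - v * p

theorem hasDerivAt_phase {m : ℝ} (hm : 0 < m) (v p : ℝ) :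
    HasDerivAt (phase m v) (Real.sin p / density m p - v) p := by
  convert! (hasDerivAt_freq hm p).sub ((hasDerivAt_id p).const_mul v) using 1
  rw [mul_one]

theorem continuous_phase (m v : ℝ) : Continuous (phase m v) := by
  have := continuous_freq (m := m)
  unfold phase; fun_prop

theorem continuous_deriv_phase {m : ℝ} (hm : 0 < m) (v : ℝ) :
    Continuous fun p => Real.sin p / density m p - v :=
  (Real.continuous_sin.div continuous_density fun p => (density_pos hm p).ne').sub
    continuous_const

/-- The factor `1 - v (sin p + sin q) / (S(p) + S(q))` of the derivative of the phase. -/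
noncomputable def phaseFactor (m v q p : ℝ) : ℝ :=
  1 - v * (Real.sin p + Real.sin q) / (density m p + density m q)

theorem abs_ratio_lt_one {m v : ℝ} (hm : 0 < m) (hv : |v| < 1) (q p : ℝ) :
    |v * (Real.sin p + Real.sin q) / (density m p + density m q)| < 1 := by
  have h1 := abs_sin_lt_density hm p
  have h2 := abs_sin_lt_density hm q
  have h0 : 0 < density m p + density m q := add_pos (density_pos hm p) (density_pos hm q)
  rw [abs_div, abs_of_pos h0, div_lt_one h0, abs_mul]
  calc |v| * |Real.sin p + Real.sin q| ≤ 1 * |Real.sin p + Real.sin q| := by gcongr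
    _ ≤ |Real.sin p| + |Real.sin q| := by rw [one_mul]; exact abs_add_le _ _
    _ < _ := add_lt_add h1 h2

theorem phaseFactor_pos {m v : ℝ} (hm : 0 < m) (hv : |v| < 1) (q p : ℝ) :
    0 < phaseFactor m v q p := by
  have := (abs_lt.1 (abs_ratio_lt_one hm hv q p)).2
  unfold phaseFactor; linarith

theorem phaseFactor_lt_two {m v : ℝ} (hm : 0 < m) (hv : |v| < 1) (q p : ℝ) :
    phaseFactor m v q p < 2 := by
  have := (abs_lt.1 (abs_ratio_lt_one hm hv q p)).1
  unfold phaseFactor; linarith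

theorem contDiff_phaseFactor {m : ℝ} (hm : 0 < m) (v q : ℝ) :
    ContDiff ℝ 1 (phaseFactor m v q) := by
  have := contDiff_density hm
  exact contDiff_const.sub (ContDiff.div (by fun_prop) (by fun_prop)
    fun p => (add_pos (density_pos hm p) (density_pos hm q)).ne')

/-- Subtract `sin q - v S(q) = 0` from the numerator `sin p - v S(p)` and use `S(p)² - S(q)² = sin²
p - sin² q`. The remaining factor is positive, so `ψ'` vanishes at `q` exactly as `sin p - sin q`
does. -/
theorem deriv_phase_eq {m v q : ℝ} (hm : 0 < m) (hq : Real.sin q = v * density m q) (p : ℝ) :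
    Real.sin p / density m p - v =
      (Real.sin p - Real.sin q) * phaseFactor m v q p / density m p := by
  have hp := density_pos hm p
  have hq' := density_pos hm q
  have h0 : density m p + density m q ≠ 0 := (add_pos hp hq').ne'
  have h1 := density_sq m p
  have h2 := density_sq m q
  rw [phaseFactor, div_sub' hp.ne']
  congr 1
  field_simp
  linear_combination (density m p + density m q) * hq - v * h1 + v * h2

theorem exp_sub_one_eq (x : ℝ) : Complex.exp (Complex.I * x) - 1 =
    2 * Complex.I * Real.sin (x / 2) * Complex.exp (Complex.I * (x / 2 : ℝ)) := by
  have h : Complex.exp (Complex.I * x) = Complex.exp (Complex.I * (x / 2 : ℝ)) ^ 2 := by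
    rw [← Complex.exp_nat_mul]; congr 1; push_cast; ring
  rw [h, mul_comm Complex.I ((x / 2 : ℝ) : ℂ), Complex.exp_mul_I, ← Complex.ofReal_cos,
    ← Complex.ofReal_sin]
  have h2 : (Real.sin (x / 2) : ℂ) ^ 2 + (Real.cos (x / 2) : ℂ) ^ 2 = 1 := by
    exact_mod_cast Real.sin_sq_add_cos_sq (x / 2)
  linear_combination h2 + (-(Real.sin (x / 2) : ℂ) ^ 2) * Complex.I_sq

/-- `e^{i(p-q)} - 1` is divisible by the derivative of the phase when `q` is the stationary
point. -/
theorem exists_factor {m v q : ℝ} (hm : 0 < m) (hv : |v| < 1)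
    (hq : Real.sin q = v * density m q) (hq' : q ∈ Set.Ioo (-(π / 2)) (π / 2)) :
    ∃ H : ℝ → ℂ, ∀ p ∈ Set.Icc (-(π / 2)) (π / 2), ContDiffAt ℝ 1 H p ∧
      (Complex.exp (Complex.I * (p - q : ℝ)) - 1) / density m p =
        ((Real.sin p / density m p - v : ℝ) : ℂ) * H p := by
  -- `e^{i(p-q)} - 1` and `sin p - sin q` share the factor `2 sin ((p - q) / 2)`; the witness is
  -- what remains after cancelling it.
  refine ⟨fun p => Complex.I * Complex.exp (Complex.I * ((p - q) / 2 : ℝ)) *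
    (((Real.cos ((p + q) / 2) * phaseFactor m v q p)⁻¹ : ℝ) : ℂ), fun p hp => ⟨?_, ?_⟩⟩
  all_goals
    -- Since `q` is interior, `|p + q| < π` even when `p` is an endpoint.
    have hcos : Real.cos ((p + q) / 2) * phaseFactor m v q p ≠ 0 :=
      mul_ne_zero (Real.cos_pos_of_mem_Ioo
        ⟨by linarith [hp.1, hq'.1], by linarith [hp.2, hq'.2]⟩).ne' (phaseFactor_pos hm hv q p).ne'
  · have hF := contDiff_phaseFactor hm v q
    have h1 : ContDiffAt ℝ 1 (fun p => (Real.cos ((p + q) / 2) * phaseFactor m v q p)⁻¹) p :=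
      ContDiffAt.inv (by fun_prop) hcos
    have h2 := Complex.ofRealCLM.contDiff.contDiffAt.comp p h1
    have h3 : ContDiff ℝ 1 fun p : ℝ => (((p - q) / 2 : ℝ) : ℂ) :=
      Complex.ofRealCLM.contDiff.comp ((contDiff_id.sub contDiff_const).div_const 2)
    exact (contDiff_const.mul (contDiff_const.mul h3).cexp).contDiffAt.mul h2
  · have hd := density_pos hm p
    rw [deriv_phase_eq hm hq, exp_sub_one_eq, Real.sin_sub_sin]
    have h1 : (density m p : ℂ) ≠ 0 := by exact_mod_cast hd.ne'
    have h2 : (Real.cos ((p + q) / 2) : ℂ) ≠ 0 := by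
      exact_mod_cast (mul_ne_zero_iff.1 hcos).1
    have h3 : (phaseFactor m v q p : ℂ) ≠ 0 := by exact_mod_cast (mul_ne_zero_iff.1 hcos).2
    simp only [Complex.ofReal_mul, Complex.ofReal_div, Complex.ofReal_inv, Complex.ofReal_ofNat]
    field_simp

/-! ### Decay when the amplitude vanishes at the stationary point -/

/-- The oscillatory integral with amplitude `f` and phase `t (ω(p) - v p)`. -/
noncomputable def oscInt (m v : ℝ) (f : ℝ → ℂ) (t : ℝ) : ℂ :=
  ∫ p in (-(π / 2))..(π / 2), f p / density m p * Complex.exp (Complex.I * (t * phase m v p : ℝ))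

theorem oscInt_integrable {m : ℝ} (hm : 0 < m) (v : ℝ) {f : ℝ → ℂ} (hf : Continuous f) (t : ℝ) :
    IntervalIntegrable
      (fun p => f p / density m p * Complex.exp (Complex.I * (t * phase m v p : ℝ)))
      MeasureTheory.volume (-(π / 2)) (π / 2) := by
  have h1 := continuous_phase m v
  have h2 := continuous_density (m := m)
  refine Continuous.intervalIntegrable (Continuous.mul (Continuous.div hf (by fun_prop) ?_)
    (by fun_prop)) _ _
  exact fun p => by exact_mod_cast (density_pos hm p).ne'

theorem oscInt_add {m : ℝ} (hm : 0 < m) (v : ℝ) {f g : ℝ → ℂ} (hf : Continuous f)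
    (hg : Continuous g) (t : ℝ) :
    oscInt m v (fun p => f p + g p) t = oscInt m v f t + oscInt m v g t := by
  rw [oscInt, oscInt, oscInt,
    ← intervalIntegral.integral_add (oscInt_integrable hm v hf t) (oscInt_integrable hm v hg t)]
  congr 1
  ext p
  ring

theorem oscInt_const_mul (m v : ℝ) (c : ℂ) (f : ℝ → ℂ) (t : ℝ) :
    oscInt m v (fun p => c * f p) t = c * oscInt m v f t := by
  rw [oscInt, oscInt, ← intervalIntegral.integral_const_mul]
  congr 1
  ext p
  ring

/-- Uniform decay for amplitudes that vanish at the stationary point. -/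
theorem exists_oscInt_le {m v q : ℝ} (hm : 0 < m) (hv : |v| < 1)
    (hq : Real.sin q = v * density m q) (hq' : q ∈ Set.Ioo (-(π / 2)) (π / 2)) :
    ∃ C, 0 ≤ C ∧ ∀ (K : ℝ → ℂ) (M t : ℝ), 0 < t →
      (∀ p ∈ Set.Icc (-(π / 2)) (π / 2),
        ContDiffAt ℝ 1 K p ∧ ‖K p‖ ≤ M ∧ ‖deriv K p‖ ≤ M) →
      ‖oscInt m v (fun p => (Complex.exp (Complex.I * (p - q : ℝ)) - 1) * K p) t‖ ≤ C * M / t := by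
  obtain ⟨H, hH⟩ := exists_factor hm hv hq hq'
  obtain ⟨B, hB0, hB⟩ := exists_bound_deriv fun p hp => (hH p hp).1
  have hπ : -(π / 2) ≤ π / 2 := by linarith [Real.pi_pos]
  refine ⟨(2 + (π / 2 - -(π / 2))) * (2 * B), by positivity, fun K M t ht hK => ?_⟩
  have hMn : 0 ≤ M := (norm_nonneg _).trans (hK _ (Set.left_mem_Icc.2 hπ)).2.1
  have := norm_integral_deriv_mul_exp_le (G := fun p => H p * K p) (M := 2 * B * M) hπ
    (hasDerivAt_phase hm v) (continuous_deriv_phase hm v)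
    (fun p hp => (hH p hp).1.mul (hK p hp).1) ?_ ?_ ht
  · rw [mul_assoc _ (2 * B) M]
    refine le_trans (le_of_eq ?_) this
    rw [oscInt]
    congr 1
    refine intervalIntegral.integral_congr fun p hp => ?_
    rw [Set.uIcc_of_le hπ] at hp
    have h := (hH p hp).2
    rw [mul_div_right_comm, h]
    ring
  · intro p hp
    rw [norm_mul]
    have h1 := (hB p hp).1
    have h2 := (hK p hp).2.1
    calc ‖H p‖ * ‖K p‖ ≤ B * M := by gcongr
      _ ≤ 2 * B * M := by nlinarith [mul_nonneg hB0 hMn]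
  · intro p hp
    have h := ((hH p hp).1.differentiableAt one_ne_zero).hasDerivAt.mul
      ((hK p hp).1.differentiableAt one_ne_zero).hasDerivAt
    rw [show (fun p => H p * K p) = H * K from rfl, h.deriv]
    obtain ⟨h1, h1'⟩ := hB p hp
    obtain ⟨-, h2, h2'⟩ := hK p hp
    calc _ ≤ ‖deriv H p‖ * ‖K p‖ + ‖H p‖ * ‖deriv K p‖ := by
          refine (norm_add_le _ _).trans ?_
          rw [norm_mul, norm_mul]
      _ ≤ B * M + B * M := by gcongr
      _ = _ := by ring

/-- The plane wave `e^{-i p r}`. -/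
noncomputable def planeWave (r p : ℝ) : ℂ := Complex.exp (Complex.I * (-(p * r) : ℝ))

theorem norm_planeWave (r p : ℝ) : ‖planeWave r p‖ = 1 := norm_exp_I_mul _

theorem continuous_planeWave (r : ℝ) : Continuous (planeWave r) := by
  unfold planeWave; fun_prop

theorem contDiff_exp_I_mul {f : ℝ → ℝ} (hf : ContDiff ℝ 1 f) :
    ContDiff ℝ 1 fun p => Complex.exp (Complex.I * (f p : ℝ)) :=
  (contDiff_const.mul (Complex.ofRealCLM.contDiff.comp hf)).cexp

theorem contDiff_planeWave (r : ℝ) : ContDiff ℝ 1 (planeWave r) :=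
  contDiff_exp_I_mul (by fun_prop)

theorem norm_deriv_planeWave (r p : ℝ) : ‖deriv (planeWave r) p‖ = |r| := by
  have h : HasDerivAt (planeWave r)
      (Complex.exp (Complex.I * (-(p * r) : ℝ)) * (Complex.I * (-(1 * r) : ℝ))) p :=
    (((((hasDerivAt_id p).mul_const r).neg).ofReal_comp).const_mul Complex.I).cexp
  rw [h.deriv, norm_mul, norm_exp_I_mul, norm_mul, Complex.norm_I, Complex.norm_real]
  simp

theorem wave_eq_im_oscInt {m : ℝ} (hm : 0 < m) (v : ℝ) (x : ℤ) (t : ℕ) :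
    wave m x t = (oscInt m v (planeWave (x - v * t)) t).im := by
  have h := Complex.imCLM.intervalIntegral_comp_comm
    (oscInt_integrable hm v (continuous_planeWave (x - v * t)) t)
  rw [← Complex.imCLM_apply, oscInt, ← h, wave]
  congr 1
  ext p
  rw [planeWave, div_mul_eq_mul_div, ← Complex.exp_add, ← mul_add, ← Complex.ofReal_add,
    Complex.imCLM_apply, Complex.div_ofReal_im, mul_comm Complex.I, Complex.exp_ofReal_mul_I_im]
  congr 2
  rw [phase]
  ring

/-- The geometric sum extracts the factor `e^{i(p-q)} - 1`. Only the derivative of the plane wave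
depends on the size of `r`, hence growth linear in `|r|`, which is affordable for `r = o(√t)`. -/
theorem norm_oscInt_geom_le {m v q : ℝ} (hm : 0 < m) (hv : |v| < 1)
    (hq : Real.sin q = v * density m q) (hq' : q ∈ Set.Ioo (-(π / 2)) (π / 2)) (n : ℕ) :
    ∃ C, 0 ≤ C ∧ ∀ r t : ℝ, 0 < t →
      ‖oscInt m v (fun p => (Complex.exp (Complex.I * (p - q : ℝ)) ^ n - 1) * planeWave r p) t‖
        ≤ C * (1 + |r|) / t := by
  obtain ⟨C, hC0, hC⟩ := exists_oscInt_le hm hv hq hq'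
  set P : ℝ → ℂ := fun p => ∑ j ∈ Finset.range n, Complex.exp (Complex.I * (p - q : ℝ)) ^ j
  have hP : ContDiff ℝ 1 P :=
    ContDiff.sum fun j _ => (contDiff_exp_I_mul (contDiff_id.sub contDiff_const)).pow j
  obtain ⟨B, hB0, hB⟩ := exists_bound_deriv (a := -(π / 2)) (b := π / 2)
    fun p _ => hP.contDiffAt (x := p)
  refine ⟨C * B, by positivity, fun r t ht => ?_⟩
  have := hC (fun p => P p * planeWave r p) (B * (1 + |r|)) t ht fun p hp => ⟨?_, ?_, ?_⟩
  · rw [mul_assoc]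
    refine le_trans (le_of_eq ?_) this
    congr 2
    ext p
    rw [← mul_assoc, mul_geom_sum]
  · exact (hP.mul (contDiff_planeWave r)).contDiffAt
  · rw [norm_mul, norm_planeWave, mul_one]
    nlinarith [(hB p hp).1, mul_nonneg hB0 (abs_nonneg r)]
  · have h := (hP.contDiffAt.differentiableAt one_ne_zero).hasDerivAt.mul
      ((contDiff_planeWave r).contDiffAt.differentiableAt one_ne_zero (x := p)).hasDerivAt
    rw [show (fun p => P p * planeWave r p) = P * planeWave r from rfl, h.deriv]
    refine (norm_add_le _ _).trans ?_
    rw [norm_mul, norm_mul, norm_planeWave, norm_deriv_planeWave, mul_one, mul_add, mul_one]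
    exact add_le_add (hB p hp).2 (mul_le_mul_of_nonneg_right (hB p hp).1 (abs_nonneg r))

/-- The entire function `(e^z - 1) / z`. -/
noncomputable def expQuot : ℂ → ℂ := dslope Complex.exp 0

theorem mul_expQuot (z : ℂ) : z * expQuot z = Complex.exp z - 1 := by
  have := sub_smul_dslope Complex.exp 0 z
  simpa [expQuot] using this

theorem differentiable_expQuot : Differentiable ℂ expQuot := by
  have := (Complex.differentiableOn_dslope (f := Complex.exp) (s := Set.univ) (c := 0)
    Filter.univ_mem).2 Complex.differentiable_exp.differentiableOn
  exact differentiableOn_univ.1 this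

theorem contDiff_expQuot : ContDiff ℂ 1 expQuot := differentiable_expQuot.contDiff

theorem expQuot_ne_zero {u : ℝ} (hu : |u| < 2 * π) : expQuot (Complex.I * u) ≠ 0 := by
  intro h
  have h1 := mul_expQuot (Complex.I * u)
  rw [h, mul_zero, eq_comm, sub_eq_zero, Complex.exp_eq_one_iff] at h1
  obtain ⟨n, hn⟩ := h1
  have h2 : u = n * (2 * π) := by
    have : (Complex.I * u).im = ((n : ℂ) * (2 * π * Complex.I)).im := by rw [hn]
    simpa using this
  have hn0 : n = 0 := by
    rw [h2, abs_mul, abs_of_pos Real.two_pi_pos, mul_lt_iff_lt_one_left Real.two_pi_pos] at hu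
    exact Int.abs_lt_one_iff.1 (by exact_mod_cast hu)
  rw [hn0, Int.cast_zero, zero_mul] at h2
  rw [h2] at h
  simp [expQuot] at h

/-- To order `1/t` the plane wave may be frozen at `q`. As `r` is real, no geometric sum is
available; instead `e^{-i(p-q)r} - 1` is divided by `e^{i(p-q)} - 1` through `expQuot`, whose
relevant values are nonzero because `|p - q| < π`. Compactness makes the bound uniform in `|r| ≤ R`.
-/
theorem norm_oscInt_planeWave_sub_le {m v q : ℝ} (hm : 0 < m) (hv : |v| < 1)
    (hq : Real.sin q = v * density m q) (hq' : q ∈ Set.Ioo (-(π / 2)) (π / 2)) (R : ℝ) :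
    ∃ C, 0 ≤ C ∧ ∀ r t : ℝ, |r| ≤ R → 0 < t →
      ‖oscInt m v (planeWave r) t - planeWave r q * oscInt m v (fun _ => 1) t‖ ≤ C / t := by
  obtain ⟨C, hC0, hC⟩ := exists_oscInt_le hm hv hq hq'
  have hπ := Real.pi_pos
  have habs : ∀ p ∈ Set.Icc (-(π / 2)) (π / 2), |p - q| < π := fun p hp =>
    abs_lt.2 ⟨by linarith [hp.1, hq'.2], by linarith [hp.2, hq'.1]⟩
  have hne : ∀ p ∈ Set.Icc (-(π / 2)) (π / 2), expQuot (Complex.I * (p - q : ℝ)) ≠ 0 :=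
    fun p hp => expQuot_ne_zero ((habs p hp).trans (by linarith))
  have hcd : ∀ c : ℝ, ContDiff ℝ 1 fun p : ℝ => expQuot (Complex.I * ((p - q) * c : ℝ)) :=
    fun c => (contDiff_expQuot.restrict_scalars ℝ).comp (contDiff_const.mul
      (Complex.ofRealCLM.contDiff.comp ((contDiff_id.sub contDiff_const).mul contDiff_const)))
  set W : ℝ → ℂ := fun p => (expQuot (Complex.I * (p - q : ℝ)))⁻¹
  have hW : ∀ p ∈ Set.Icc (-(π / 2)) (π / 2), ContDiffAt ℝ 1 W p := fun p hp => by
    have := hcd 1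
    simp only [mul_one] at this
    exact this.contDiffAt.inv (hne p hp)
  obtain ⟨B, hB0, hB⟩ := exists_bound_deriv hW
  obtain ⟨E₁, hE₁⟩ := (isCompact_closedBall (0 : ℂ) (π * R)).exists_bound_of_continuousOn
    contDiff_expQuot.continuous.continuousOn
  obtain ⟨E₂, hE₂⟩ := (isCompact_closedBall (0 : ℂ) (π * R)).exists_bound_of_continuousOn
    (contDiff_expQuot.continuous_deriv le_rfl).continuousOn
  refine ⟨C * (B * (|R| * |E₁|) + B * (|R| * (|E₂| * |R|))), by positivity,
    fun r t hr ht => ?_⟩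
  have hrR : |r| ≤ |R| := hr.trans (le_abs_self R)
  set V : ℝ → ℂ := fun p => -(planeWave r q * r) * expQuot (Complex.I * ((p - q) * (-r) : ℝ))
  have hV : ContDiff ℝ 1 V := contDiff_const.mul (hcd (-r))
  have hz : ∀ p ∈ Set.Icc (-(π / 2)) (π / 2),
      Complex.I * ((p - q) * (-r) : ℝ) ∈ Metric.closedBall (0 : ℂ) (π * R) := fun p hp => by
    rw [mem_closedBall_zero_iff, norm_mul, Complex.norm_I, one_mul, Complex.norm_real,
      Real.norm_eq_abs, abs_mul, abs_neg]
    exact mul_le_mul (habs p hp).le hr (abs_nonneg r) hπ.le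
  have hV0 : ∀ p ∈ Set.Icc (-(π / 2)) (π / 2), ‖V p‖ ≤ |R| * |E₁| := fun p hp => by
    simp only [V]
    rw [norm_mul, norm_neg, norm_mul, norm_planeWave, one_mul, Complex.norm_real,
      Real.norm_eq_abs]
    exact mul_le_mul hrR ((hE₁ _ (hz p hp)).trans (le_abs_self _)) (norm_nonneg _)
      (abs_nonneg _)
  have hV1 : ∀ p ∈ Set.Icc (-(π / 2)) (π / 2), ‖deriv V p‖ ≤ |R| * (|E₂| * |R|) := fun p hp => by
    have h1 : HasDerivAt (fun p : ℝ => Complex.I * ((p - q) * (-r) : ℝ))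
        (Complex.I * (1 * (-r) : ℝ)) p :=
      ((((hasDerivAt_id p).sub_const q).mul_const (-r)).ofReal_comp).const_mul Complex.I
    have h2 := ((differentiable_expQuot _).hasDerivAt.comp p h1).const_mul (-(planeWave r q * r))
    have h3 : deriv V p = _ := h2.deriv
    rw [h3, norm_mul, norm_neg, norm_mul, norm_planeWave, one_mul, Complex.norm_real,
      Real.norm_eq_abs, norm_mul, norm_mul, Complex.norm_I, Complex.norm_real, Real.norm_eq_abs,
      one_mul, one_mul, abs_neg]
    refine mul_le_mul hrR (mul_le_mul ((hE₂ _ (hz p hp)).trans (le_abs_self _)) hrR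
      (abs_nonneg _) (abs_nonneg _)) (by positivity) (abs_nonneg _)
  have key := hC (fun p => W p * V p) (B * (|R| * |E₁|) + B * (|R| * (|E₂| * |R|))) t ht
    fun p hp => ⟨(hW p hp).mul hV.contDiffAt, ?_, ?_⟩
  · refine le_trans (le_of_eq ?_) key
    congr 1
    rw [sub_eq_add_neg, ← neg_mul, ← oscInt_const_mul,
      ← oscInt_add hm v (continuous_planeWave r) (by fun_prop)]
    rw [oscInt, oscInt]
    refine intervalIntegral.integral_congr fun p hp => ?_
    rw [Set.uIcc_of_le (by linarith)] at hp
    simp only [W, V]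
    congr 2
    have h1 := mul_expQuot (Complex.I * (p - q : ℝ))
    have h2 := mul_expQuot (Complex.I * ((p - q) * (-r) : ℝ))
    have h3 : planeWave r p = planeWave r q * Complex.exp (Complex.I * ((p - q) * (-r) : ℝ)) := by
      rw [planeWave, planeWave, ← Complex.exp_add]
      congr 1
      push_cast
      ring
    rw [← h1, h3, eq_add_of_sub_eq h2.symm]
    have := hne p hp
    field_simp
    push_cast
    ring
  · rw [norm_mul]
    have := mul_le_mul (hB p hp).1 (hV0 p hp) (norm_nonneg _) hB0
    have h0 : 0 ≤ B * (|R| * (|E₂| * |R|)) := by positivity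
    linarith
  · have h := ((hW p hp).differentiableAt one_ne_zero).hasDerivAt.mul
      (hV.contDiffAt.differentiableAt one_ne_zero (x := p)).hasDerivAt
    rw [show (fun p => W p * V p) = W * V from rfl, h.deriv]
    refine (norm_add_le _ _).trans ?_
    rw [norm_mul (deriv W p), norm_mul (W p)]
    exact add_le_add (mul_le_mul (hB p hp).2 (hV0 p hp) (norm_nonneg _) hB0)
      (mul_le_mul (hB p hp).1 (hV1 p hp) (norm_nonneg _) hB0)

/-- The difference of two values of the wave function as an oscillatory integral. -/
theorem a₁_sub_eq {m : ℝ} (hm : 0 < m) (v : ℝ) (T t : ℕ) (x : ℤ) :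
    a₁ x t m 1 - a₁ ((x : ℝ) - 2 * T) t m 1 =
      (1 - (x + t).negOnePow : ℝ) * (m / (2 * π)) *
        (oscInt m v (planeWave (x - v * t)) t -
          oscInt m v (planeWave (x - v * t - 2 * T)) t).im := by
  have h1 : (x : ℝ) - 2 * T = ((x - 2 * T : ℤ) : ℝ) := by push_cast; rfl
  have h2 : (x - 2 * T + t : ℤ).negOnePow = (x + t).negOnePow := by
    have : (x - 2 * T + t : ℤ) = x + t - 2 * T := by ring
    rw [this, Int.negOnePow_sub, Int.negOnePow_even _ (even_two_mul _), mul_one]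
  rw [h1, a₁_eq_wave hm, a₁_eq_wave hm, h2, wave_eq_im_oscInt hm v, wave_eq_im_oscInt hm v,
    Complex.sub_im, mul_sub]
  have h3 : ((x - 2 * T : ℤ) : ℝ) - v * t = x - v * t - 2 * T := by push_cast; ring
  rw [h3]

/-! ### Mean-square lower bound for the stationary phase integral -/

theorem norm_oscInt_one_neg (m v t : ℝ) :
    ‖oscInt m v (fun _ => 1) (-t)‖ = ‖oscInt m v (fun _ => 1) t‖ := by
  rw [← RCLike.norm_conj (oscInt m v (fun _ => 1) t), oscInt, oscInt,
    ← intervalIntegral.intervalIntegral_conj]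
  congr 2
  ext p
  rw [map_mul, map_div₀, map_one, Complex.conj_ofReal, ← Complex.exp_conj, map_mul,
    Complex.conj_I, Complex.conj_ofReal]
  congr 2
  push_cast
  ring

/-- In one row of a Toeplitz matrix each value of `|s - t|` occurs at most twice. -/
theorem sum_abs_sub_le {f : ℝ → ℝ} (hf : ∀ x, 0 ≤ f x) (hneg : ∀ x, f (-x) = f x) (N s : ℕ)
    (hs : s < N) :
    ∑ t ∈ Finset.range N, f ((s : ℝ) - t) ≤ 2 * ∑ k ∈ Finset.range N, f k := by
  rw [← Finset.sum_range_add_sum_Ico _ hs, two_mul]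
  refine add_le_add ?_ ?_
  · rw [← Finset.sum_range_reflect]
    refine le_trans (le_of_eq (Finset.sum_congr rfl fun k hk => ?_))
      (Finset.sum_le_sum_of_subset_of_nonneg (Finset.range_mono hs) fun i _ _ => hf i)
    have := Finset.mem_range.1 hk
    congr 1
    rw [show s.succ - 1 - k = s - k by omega, Nat.cast_sub (by omega)]
    ring
  · rw [Finset.sum_Ico_eq_sum_range]
    calc _ = ∑ k ∈ Finset.range (N - s.succ), f ((k + 1 : ℕ) : ℝ) := by
          refine Finset.sum_congr rfl fun k _ => ?_
          rw [← hneg]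
          congr 1
          push_cast
          ring
      _ ≤ ∑ k ∈ Finset.range (N - s.succ + 1), f k := by
          rw [Finset.sum_range_succ']
          exact le_add_of_nonneg_right (hf _)
      _ ≤ _ := Finset.sum_le_sum_of_subset_of_nonneg (Finset.range_mono (by omega))
          fun i _ _ => hf i

/-- The quadratic bound for the phase at its stationary point. -/
theorem abs_phase_sub_le {m v q p : ℝ} (hm : 0 < m) (hv : |v| < 1)
    (hq : Real.sin q = v * density m q) (hp : q ≤ p) :
    |phase m v p - phase m v q| ≤ 2 / m * (p - q) ^ 2 := by
  -- Mean value inequality: on `[q, p]` the derivative is at most `2 (p - q) / m`, from `|sin z -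
  -- sin q| ≤ p - q`, a phase factor below 2 and `S ≥ m`.
  have h := Convex.norm_image_sub_le_of_norm_hasDerivWithin_le (f := phase m v)
    (f' := fun p => Real.sin p / density m p - v) (s := Set.Icc q p) (x := q) (y := p)
    (C := 2 / m * (p - q)) (fun z _ => (hasDerivAt_phase hm v z).hasDerivWithinAt) ?_
    (convex_Icc q p) (Set.left_mem_Icc.2 hp) (Set.right_mem_Icc.2 hp)
  · rw [Real.norm_eq_abs, Real.norm_eq_abs, abs_of_nonneg (sub_nonneg.2 hp)] at h
    rw [sq, ← mul_assoc]
    exact h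
  · intro z hz
    have hd := density_pos hm z
    have hmd : m ≤ density m z := Real.le_sqrt_of_sq_le (by nlinarith [sq_nonneg (Real.sin z)])
    have h1 : |Real.sin z - Real.sin q| ≤ p - q := by
      rw [Real.sin_sub_sin, abs_mul, abs_mul, abs_two]
      have a1 := Real.abs_sin_le_abs (x := (z - q) / 2)
      have a2 := Real.abs_cos_le_one ((z + q) / 2)
      rw [abs_of_nonneg (by linarith [hz.1] : 0 ≤ (z - q) / 2)] at a1
      calc _ ≤ 2 * ((z - q) / 2) * 1 :=
            mul_le_mul (by linarith) a2 (abs_nonneg _) (by linarith [hz.1])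
        _ ≤ _ := by linarith [hz.2]
    rw [deriv_phase_eq hm hq, Real.norm_eq_abs, abs_div, abs_mul, abs_of_pos hd,
      abs_of_pos (phaseFactor_pos hm hv q z), div_mul_eq_mul_div, mul_comm 2]
    have h2 := (phaseFactor_lt_two hm hv q z).le
    have h3 := (phaseFactor_pos hm hv q z).le
    gcongr

/-- The exponential sum `∑_{s < N} e^{i s (ψ(p) - ψ(q))}`. -/
noncomputable def phaseSum (m v q : ℝ) (N : ℕ) (p : ℝ) : ℂ :=
  ∑ s ∈ Finset.range N, Complex.exp (Complex.I * (s * (phase m v p - phase m v q) : ℝ))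

theorem continuous_phaseSum (m v q : ℝ) (N : ℕ) : Continuous (phaseSum m v q N) := by
  have := continuous_phase m v
  unfold phaseSum
  fun_prop

theorem half_le_norm_phaseSum {m v q p : ℝ} {N : ℕ}
    (h : N * |phase m v p - phase m v q| ≤ 1) : (N : ℝ) / 2 ≤ ‖phaseSum m v q N p‖ := by
  refine le_trans ?_ (Complex.re_le_norm _)
  rw [phaseSum, Complex.re_sum]
  have : ∀ s ∈ Finset.range N, (1 / 2 : ℝ) ≤
      (Complex.exp (Complex.I * (s * (phase m v p - phase m v q) : ℝ))).re := by
    intro s hs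
    rw [mul_comm, Complex.exp_ofReal_mul_I_re]
    refine le_trans ?_ (Real.one_sub_sq_div_two_le_cos)
    have hs' : (s : ℝ) ≤ N := by exact_mod_cast (Finset.mem_range.1 hs).le
    have h1 : |(s : ℝ) * (phase m v p - phase m v q)| ≤ 1 := by
      rw [abs_mul, Nat.abs_cast]
      exact (mul_le_mul_of_nonneg_right hs' (abs_nonneg _)).trans h
    have h2 := (sq_le_one_iff_abs_le_one _).2 h1
    linarith
  have h3 := Finset.card_nsmul_le_sum _ _ _ this
  rw [Finset.card_range, nsmul_eq_mul] at h3
  linarith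

/-- Expanding the square gives a double sum of the integrals `J(s - t)` with unimodular
coefficients; each of the `N` rows is bounded separately. -/
theorem integral_normSq_phaseSum_le {m : ℝ} (hm : 0 < m) (v q : ℝ) (N : ℕ) :
    ∫ p in (-(π / 2))..(π / 2), ‖phaseSum m v q N p‖ ^ 2 / density m p ≤
      N * (2 * ∑ k ∈ Finset.range N, ‖oscInt m v (fun _ => 1) k‖) := by
  have hexp : ∀ p, ((‖phaseSum m v q N p‖ ^ 2 / density m p : ℝ) : ℂ) =
      ∑ s ∈ Finset.range N, ∑ t ∈ Finset.range N,
        Complex.exp (Complex.I * (-((s - t) * phase m v q) : ℝ)) *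
          (1 / density m p * Complex.exp (Complex.I * (((s : ℝ) - t) * phase m v p : ℝ))) := by
    intro p
    rw [Complex.ofReal_div, Complex.ofReal_pow, ← Complex.mul_conj', phaseSum, map_sum,
      Finset.sum_mul_sum, Finset.sum_div]
    refine Finset.sum_congr rfl fun s _ => ?_
    rw [Finset.sum_div]
    refine Finset.sum_congr rfl fun t _ => ?_
    rw [mul_left_comm, one_div, div_eq_inv_mul, ← Complex.exp_add, ← Complex.exp_conj,
      ← Complex.exp_add, map_mul, Complex.conj_I, Complex.conj_ofReal]
    congr 2
    push_cast
    ring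
  have hint : ((∫ p in (-(π / 2))..(π / 2), ‖phaseSum m v q N p‖ ^ 2 / density m p : ℝ) : ℂ) =
      ∑ s ∈ Finset.range N, ∑ t ∈ Finset.range N,
        Complex.exp (Complex.I * (-((s - t) * phase m v q) : ℝ)) *
          oscInt m v (fun _ => 1) ((s : ℝ) - t) := by
    have hi : ∀ s t : ℕ, IntervalIntegrable (fun p =>
        Complex.exp (Complex.I * (-(((s : ℝ) - t) * phase m v q) : ℝ)) *
          (1 / density m p * Complex.exp (Complex.I * (((s : ℝ) - t) * phase m v p : ℝ))))
        MeasureTheory.volume (-(π / 2)) (π / 2) := fun s t =>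
      (oscInt_integrable hm v continuous_const _).const_mul _
    rw [← intervalIntegral.integral_ofReal]
    simp only [hexp]
    rw [intervalIntegral.integral_finsetSum]
    · refine Finset.sum_congr rfl fun s _ => ?_
      rw [intervalIntegral.integral_finsetSum fun t _ => hi s t]
      refine Finset.sum_congr rfl fun t _ => ?_
      rw [intervalIntegral.integral_const_mul, oscInt]
    · intro s _
      have := IntervalIntegrable.sum (Finset.range N) fun t _ => hi s t
      simpa only [Finset.sum_fn] using this
  have hle : ∫ p in (-(π / 2))..(π / 2), ‖phaseSum m v q N p‖ ^ 2 / density m p ≤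
      ‖((∫ p in (-(π / 2))..(π / 2), ‖phaseSum m v q N p‖ ^ 2 / density m p : ℝ) : ℂ)‖ := by
    rw [Complex.norm_real]; exact Real.le_norm_self _
  refine hle.trans ?_
  rw [hint]
  refine (norm_sum_le _ _).trans ?_
  have hrow : ∀ s ∈ Finset.range N, ‖∑ t ∈ Finset.range N,
      Complex.exp (Complex.I * (-((s - t) * phase m v q) : ℝ)) *
        oscInt m v (fun _ => 1) ((s : ℝ) - t)‖ ≤
      2 * ∑ k ∈ Finset.range N, ‖oscInt m v (fun _ => 1) k‖ := by
    intro s hs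
    refine (norm_sum_le _ _).trans ?_
    simp only [norm_mul, norm_exp_I_mul, one_mul]
    exact sum_abs_sub_le (f := fun x => ‖oscInt m v (fun _ => 1) x‖) (fun _ => norm_nonneg _)
      (norm_oscInt_one_neg m v) N s (Finset.mem_range.1 hs)
  refine (Finset.sum_le_sum hrow).trans ?_
  rw [Finset.sum_const, Finset.card_range, nsmul_eq_mul]

theorem le_integral_normSq_phaseSum {m v q : ℝ} (hm : 0 < m) (hv : |v| < 1)
    (hq : Real.sin q = v * density m q) (hq' : q ∈ Set.Ioo (-(π / 2)) (π / 2)) {N : ℕ}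
    (hN : √(m / (2 * N)) ≤ π / 2 - q) :
    √(m / (2 * N)) * ((N / 2 : ℝ) ^ 2 / √(1 + m ^ 2)) ≤
      ∫ p in (-(π / 2))..(π / 2), ‖phaseSum m v q N p‖ ^ 2 / density m p := by
  -- The window width solves `N * (2 / m) * η² = 1`: to the right of `q` within it, all `N` phases
  -- stay at most 1 in absolute value and the sum has size at least `N / 2`.
  set η := √(m / (2 * N)) with hη
  have hη0 : 0 ≤ η := Real.sqrt_nonneg _
  have hcont : Continuous fun p => ‖phaseSum m v q N p‖ ^ 2 / density m p :=
    ((continuous_phaseSum m v q N).norm.pow 2).div continuous_density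
      fun p => (density_pos hm p).ne'
  have hmono := intervalIntegral.integral_mono_interval (μ := MeasureTheory.volume)
    (f := fun p => ‖phaseSum m v q N p‖ ^ 2 / density m p)
    (a := q) (b := q + η) (c := -(π / 2)) (d := π / 2) hq'.1.le (by linarith) (by linarith)
    (Eventually.of_forall fun p => div_nonneg (sq_nonneg _) (density_pos hm p).le)
    (hcont.intervalIntegrable _ _)
  refine le_trans ?_ hmono
  have hconst := intervalIntegral.integral_mono_on (μ := MeasureTheory.volume)
    (a := q) (b := q + η) (f := fun _ => (N / 2 : ℝ) ^ 2 / √(1 + m ^ 2))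
    (g := fun p => ‖phaseSum m v q N p‖ ^ 2 / density m p) (by linarith)
    intervalIntegrable_const (hcont.intervalIntegrable _ _) ?_
  · rw [intervalIntegral.integral_const, add_sub_cancel_left, smul_eq_mul] at hconst
    exact hconst
  · intro p hp
    have h1 : N * |phase m v p - phase m v q| ≤ 1 := by
      have h2 := abs_phase_sub_le hm hv hq hp.1
      have h3 : (p - q) ^ 2 ≤ m / (2 * N) := by
        rw [← Real.sq_sqrt (by positivity : 0 ≤ m / (2 * N)), ← hη]
        exact pow_le_pow_left₀ (by linarith [hp.1]) (by linarith [hp.2]) 2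
      calc N * |phase m v p - phase m v q| ≤ N * (2 / m * (m / (2 * N))) :=
            mul_le_mul_of_nonneg_left (h2.trans (by gcongr)) (Nat.cast_nonneg N)
        _ ≤ 1 := by
          rcases eq_or_ne (N : ℝ) 0 with h | h
          · simp [h]
          · field_simp
            exact le_refl (1 : ℝ)
    have h4 := half_le_norm_phaseSum h1
    have h5 := density_le m p
    have h6 := density_pos hm p
    gcongr

theorem sum_inv_sqrt_le (N : ℕ) : ∑ k ∈ Finset.range N, (√(k : ℝ))⁻¹ ≤ 4 * √N := by
  induction N with
  | zero => simp
  | succ N ih =>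
    rw [Finset.sum_range_succ]
    rcases Nat.eq_zero_or_pos N with rfl | hN
    · simp
    · have hN' : (1 : ℝ) ≤ N := by exact_mod_cast hN
      have h0 : 0 < √(N : ℝ) := Real.sqrt_pos.2 (by linarith)
      have h1 : √(N : ℝ) ^ 2 = N := Real.sq_sqrt (by linarith)
      have h2 : √((N + 1 : ℕ) : ℝ) ^ 2 = N + 1 := by
        rw [Real.sq_sqrt (by positivity)]; push_cast; ring
      have h3 : √((N + 1 : ℕ) : ℝ) ≤ 3 * √(N : ℝ) :=
        abs_le_of_sq_le_sq' (by rw [mul_pow, h1, h2]; linarith) (by positivity) |>.2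
      have h4 : (√(N : ℝ))⁻¹ ≤ 4 * (√((N + 1 : ℕ) : ℝ) - √(N : ℝ)) := by
        rw [inv_le_iff_one_le_mul₀ h0]
        have h5 : √(N : ℝ) ≤ √((N + 1 : ℕ) : ℝ) := Real.sqrt_le_sqrt (by push_cast; linarith)
        nlinarith
      linarith

theorem sqrt_sub_one_le_sum (N : ℕ) :
    √(N : ℝ) - 1 ≤ ∑ k ∈ Finset.range N, (√(k : ℝ))⁻¹ := by
  induction N with
  | zero => simp
  | succ N ih =>
    rw [Finset.sum_range_succ]
    rcases Nat.eq_zero_or_pos N with rfl | hN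
    · simp
    · have hN' : (1 : ℝ) ≤ N := by exact_mod_cast hN
      have h0 : 0 < √(N : ℝ) := Real.sqrt_pos.2 (by linarith)
      have h1 : √(N : ℝ) ^ 2 = N := Real.sq_sqrt (by linarith)
      have h2 : √((N + 1 : ℕ) : ℝ) ≤ √(N : ℝ) + (√(N : ℝ))⁻¹ := by
        rw [Real.sqrt_le_left (by positivity)]
        have : (√(N : ℝ) + (√(N : ℝ))⁻¹) ^ 2 = N + 2 + (√(N : ℝ))⁻¹ ^ 2 := by
          rw [add_sq, h1]; field_simp
        rw [this]
        push_cast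
        nlinarith [sq_nonneg (√(N : ℝ))⁻¹]
      linarith

/-- The stationary phase integral is not `o(t^{-1/2})`. -/
theorem not_isLittleO_oscInt_one {m v q : ℝ} (hm : 0 < m) (hv : |v| < 1)
    (hq : Real.sin q = v * density m q) (hq' : q ∈ Set.Ioo (-(π / 2)) (π / 2)) :
    ¬ (fun t : ℕ => oscInt m v (fun _ => 1) t) =o[atTop] fun t : ℕ => (√(t : ℝ))⁻¹ := by
  intro h
  -- Summing a little-o estimate requires the comparison series to diverge. Its term at `k = 0` is
  -- `0`.
  have htend : Tendsto (fun N : ℕ => ∑ k ∈ Finset.range N, (√(k : ℝ))⁻¹) atTop atTop := by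
    refine tendsto_atTop_mono sqrt_sub_one_le_sum ?_
    exact tendsto_atTop_add_const_right _ _
      (Real.tendsto_sqrt_atTop.comp tendsto_natCast_atTop_atTop)
  have hsum := h.norm_left.sum_range (fun k => by positivity) htend
  set c := √(m / 2) / (4 * √(1 + m ^ 2)) with hc
  have hc0 : 0 < c := div_pos (Real.sqrt_pos.2 (by positivity))
    (mul_pos four_pos (sqrt_one_add_sq_pos m))
  have hsmall : ∀ᶠ N : ℕ in atTop, √(m / (2 * N)) ≤ π / 2 - q := by
    have h1 : Tendsto (fun N : ℕ => √(m / (2 * N))) atTop (nhds (√0)) := by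
      refine (Real.continuous_sqrt.tendsto 0).comp ?_
      exact tendsto_const_nhds.div_atTop
        (tendsto_natCast_atTop_atTop.const_mul_atTop two_pos)
    rw [Real.sqrt_zero] at h1
    exact (h1.eventually_lt_const (sub_pos.2 hq'.2)).mono fun _ h => h.le
  -- The mean square is at least `c N^{3/2}`. With `c / 16` here, and `4 √N` bounding the comparison
  -- sum, it is also at most half of that.
  obtain ⟨N, ⟨hN1, hN2⟩, hN3⟩ := ((hsmall.and (isLittleO_iff.1 hsum
    (by positivity : 0 < c / 16))).and (eventually_gt_atTop 0)).exists
  have hl := le_integral_normSq_phaseSum hm hv hq hq' hN1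
  have hu := integral_normSq_phaseSum_le hm v q N
  have hs := sum_inv_sqrt_le N
  have hNr : (0 : ℝ) < N := by exact_mod_cast hN3
  have hsq : 0 < √(N : ℝ) := Real.sqrt_pos.2 hNr
  rw [Real.norm_of_nonneg (Finset.sum_nonneg fun _ _ => norm_nonneg _),
    Real.norm_of_nonneg (Finset.sum_nonneg fun _ _ => by positivity)] at hN2
  have hJ : ∑ k ∈ Finset.range N, ‖oscInt m v (fun _ => 1) k‖ ≤ c / 4 * √N := by
    refine hN2.trans ?_
    calc _ ≤ c / 16 * (4 * √N) := by gcongr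
      _ = _ := by ring
  have e1 : √(m / (2 * N)) * ((N / 2 : ℝ) ^ 2 / √(1 + m ^ 2)) = c * (N * √N) := by
    have h1 := Real.sq_sqrt hNr.le
    have := sqrt_one_add_sq_pos m
    rw [hc, ← div_div, Real.sqrt_div (by positivity)]
    field_simp
    rw [h1]
    ring
  have h2 : c * (N * √N) ≤ N * (2 * (c / 4 * √N)) := by
    rw [← e1]
    exact hl.trans (hu.trans (by gcongr))
  have : 0 < c * (N * √N) := by positivity
  nlinarith

/-! ### From oscillatory integrals to the dip condition -/

theorem rpow_neg_half_eq :
    (fun t : ℕ => (t : ℝ) ^ (-1 / 2 : ℝ)) = fun t : ℕ => (√(t : ℝ))⁻¹ := by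
  ext t
  rw [Real.sqrt_eq_rpow, ← Real.rpow_neg (Nat.cast_nonneg t)]
  norm_num

theorem rpow_half_eq :
    (fun t : ℕ => (t : ℝ) ^ (1 / 2 : ℝ)) = fun t : ℕ => √(t : ℝ) := by
  ext t
  rw [Real.sqrt_eq_rpow]

theorem isLittleO_const_sqrt (c : ℝ) :
    (fun _ : ℕ => c) =o[atTop] fun t : ℕ => √(t : ℝ) :=
  isLittleO_const_left.2 (Or.inr (tendsto_norm_atTop_atTop.comp
    (Real.tendsto_sqrt_atTop.comp tendsto_natCast_atTop_atTop)))

theorem isLittleO_div_of_isLittleO_sqrt {f : ℕ → ℝ}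
    (hf : f =o[atTop] fun t : ℕ => √(t : ℝ)) :
    (fun t : ℕ => f t / t) =o[atTop] fun t : ℕ => (√(t : ℝ))⁻¹ := by
  have h := hf.mul_isBigO (isBigO_refl (fun t : ℕ => (t : ℝ)⁻¹) atTop)
  refine h.congr (fun t => by rw [div_eq_mul_inv]) fun t => ?_
  rcases Nat.eq_zero_or_pos t with rfl | ht
  · simp
  · have h0 : 0 < √(t : ℝ) := Real.sqrt_pos.2 (by exact_mod_cast ht)
    nth_rewrite 2 [← Real.sq_sqrt (Nat.cast_nonneg t)]
    field_simp

theorem abs_one_sub_negOnePow_le (n : ℤ) : |(1 - n.negOnePow : ℝ)| ≤ 2 := by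
  rcases Int.even_or_odd n with h | h
  · rw [Int.negOnePow_even n h]; norm_num
  · rw [Int.negOnePow_odd n h]; norm_num

theorem planeWave_sub (r q p : ℝ) (T : ℕ) :
    planeWave (r - 2 * T) p = planeWave (-(2 * T)) q *
      (Complex.exp (Complex.I * (p - q : ℝ)) ^ (2 * T) * planeWave r p) := by
  rw [planeWave, planeWave, planeWave, ← Complex.exp_nat_mul, ← Complex.exp_add,
    ← Complex.exp_add]
  congr 1
  push_cast
  ring

theorem planeWave_add (r s p : ℝ) : planeWave (r + s) p = planeWave r p * planeWave s p := by
  rw [planeWave, planeWave, planeWave, ← Complex.exp_add]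
  congr 1
  push_cast
  ring

/-- If the amplitude vanishes at the stationary point, the difference is `o(t^{-1/2})`. -/
theorem isLittleO_of_planeWave_eq_one {m v q : ℝ} (hm : 0 < m) (hv : |v| < 1)
    (hq : Real.sin q = v * density m q) (hq' : q ∈ Set.Ioo (-(π / 2)) (π / 2)) {T : ℕ}
    (hT : planeWave (-(2 * T)) q = 1) {x : ℕ → ℤ}
    (hx : (fun t : ℕ => (x t : ℝ) - v * (t : ℝ)) =o[atTop] fun t : ℕ => √(t : ℝ)) :
    (fun t : ℕ => a₁ (x t : ℝ) (t : ℝ) m 1 - a₁ ((x t : ℝ) - 2 * (T : ℝ)) (t : ℝ) m 1)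
      =o[atTop] fun t : ℕ => (√(t : ℝ))⁻¹ := by
  obtain ⟨C, hC0, hC⟩ := norm_oscInt_geom_le hm hv hq hq' (2 * T)
  refine IsBigO.trans_isLittleO (g := fun t : ℕ => (1 + |(x t : ℝ) - v * t|) / t) ?_
    (isLittleO_div_of_isLittleO_sqrt ((isLittleO_const_sqrt 1).add hx.norm_left))
  refine IsBigO.of_bound (2 * (m / (2 * π)) * C) ?_
  filter_upwards [eventually_gt_atTop 0] with t ht
  have htr : (0 : ℝ) < t := by exact_mod_cast ht
  have h := hC (x t - v * t) t htr
  have hdiff : oscInt m v (planeWave (x t - v * t - 2 * T)) t =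
      oscInt m v (planeWave (x t - v * t)) t + oscInt m v (fun p =>
        (Complex.exp (Complex.I * (p - q : ℝ)) ^ (2 * T) - 1) * planeWave (x t - v * t) p) t := by
    have hc := continuous_planeWave (x t - v * t)
    rw [← oscInt_add hm v hc (by fun_prop)]
    congr 1
    ext p
    rw [planeWave_sub _ q, hT]
    ring
  have hpi := Real.pi_pos
  rw [a₁_sub_eq hm v, hdiff, sub_add_cancel_left, norm_mul, norm_mul, Complex.neg_im, norm_neg,
    Real.norm_of_nonneg (by positivity : 0 ≤ m / (2 * π)),
    Real.norm_of_nonneg (by positivity : 0 ≤ (1 + |(x t : ℝ) - v * t|) / t), mul_assoc _ C,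
    ← mul_div_assoc C]
  gcongr
  · exact abs_one_sub_negOnePow_le _
  · exact (Complex.abs_im_le_norm _).trans h

/-- The one of `⌊v t⌋` and `⌊v t⌋ + 1` whose sum with `t` is odd. -/
noncomputable def oddPoint (v : ℝ) (t : ℕ) : ℤ :=
  if Even (⌊v * t⌋ + t) then ⌊v * t⌋ + 1 else ⌊v * t⌋

theorem odd_oddPoint_add (v : ℝ) (t : ℕ) : Odd (oddPoint v t + t) := by
  rw [oddPoint]
  split_ifs with h
  · have : ⌊v * t⌋ + 1 + (t : ℤ) = (⌊v * t⌋ + t) + 1 := by ring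
    rw [this]
    exact h.add_one
  · exact Int.not_even_iff_odd.1 h

theorem abs_oddPoint_sub_le (v : ℝ) (t : ℕ) : |(oddPoint v t : ℝ) - v * t| ≤ 1 := by
  have h1 := Int.floor_le (v * t)
  have h2 := Int.lt_floor_add_one (v * t)
  rw [oddPoint, abs_le]
  split_ifs
  · push_cast; constructor <;> linarith
  · constructor <;> linarith

theorem isLittleO_sqrt_of_bounded {f : ℕ → ℝ} {R : ℝ} (hf : ∀ t, |f t| ≤ R) :
    f =o[atTop] fun t : ℕ => √(t : ℝ) :=
  IsBigO.trans_isLittleO (g := fun _ : ℕ => (1 : ℝ))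
    (IsBigO.of_bound R (Eventually.of_forall fun t => by simpa using hf t))
    (isLittleO_const_sqrt 1)

/-- Along points at bounded distance from `v t` with the right parity, a difference of size
`o(t^{-1/2})` forces the same for the leading term of its asymptotic expansion. -/
theorem isLittleO_im_leading {m v q : ℝ} (hm : 0 < m) (hv : |v| < 1)
    (hq : Real.sin q = v * density m q) (hq' : q ∈ Set.Ioo (-(π / 2)) (π / 2)) {T : ℕ}
    {x : ℕ → ℤ} {R : ℝ} (hR : ∀ t, |(x t : ℝ) - v * t| ≤ R) (hodd : ∀ t, Odd (x t + (t : ℤ)))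
    (h : (fun t : ℕ => a₁ (x t : ℝ) (t : ℝ) m 1 - a₁ ((x t : ℝ) - 2 * (T : ℝ)) (t : ℝ) m 1)
      =o[atTop] fun t : ℕ => (√(t : ℝ))⁻¹) :
    (fun t : ℕ => (planeWave (x t - v * t) q * ((1 - planeWave (-(2 * T)) q) *
      oscInt m v (fun _ => 1) t)).im) =o[atTop] fun t : ℕ => (√(t : ℝ))⁻¹ := by
  -- The radius `R + 2 * T` covers both `x - v t` and its shift by `2T`.
  obtain ⟨C, hC0, hC⟩ := norm_oscInt_planeWave_sub_le hm hv hq hq' (R + 2 * T)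
  have hpi := Real.pi_pos
  have hmain : (fun t : ℕ => (planeWave (x t - v * t) q * ((1 - planeWave (-(2 * T)) q) *
      oscInt m v (fun _ => 1) t)).im -
      π / m * (a₁ (x t : ℝ) (t : ℝ) m 1 - a₁ ((x t : ℝ) - 2 * (T : ℝ)) (t : ℝ) m 1))
      =o[atTop] fun t : ℕ => (√(t : ℝ))⁻¹ := by
    refine IsBigO.trans_isLittleO (g := fun t : ℕ => (1 : ℝ) / t) ?_
      (isLittleO_div_of_isLittleO_sqrt (isLittleO_const_sqrt 1))
    refine IsBigO.of_bound (C + C) ?_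
    filter_upwards [eventually_gt_atTop 0] with t ht
    have htr : (0 : ℝ) < t := by exact_mod_cast ht
    have hT0 : (0 : ℝ) ≤ 2 * T := by positivity
    have h1 := hC (x t - v * t) t (by linarith [hR t]) htr
    have h2 := hC (x t - v * t - 2 * T) t (by
      refine (abs_sub _ _).trans ?_
      rw [abs_of_nonneg hT0]
      linarith [hR t]) htr
    have hcoef : π / m * ((1 - (x t + t).negOnePow : ℝ) * (m / (2 * π))) = 1 := by
      rw [Int.negOnePow_odd _ (hodd t)]
      push_cast
      field_simp
      norm_num
    rw [a₁_sub_eq hm v, ← mul_assoc (π / m), hcoef, one_mul, ← Complex.sub_im]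
    refine (Complex.abs_im_le_norm _).trans ?_
    have e : planeWave (x t - v * t) q * ((1 - planeWave (-(2 * T)) q) *
        oscInt m v (fun _ => 1) t) - (oscInt m v (planeWave (x t - v * t)) t -
        oscInt m v (planeWave (x t - v * t - 2 * T)) t) =
        (oscInt m v (planeWave (x t - v * t - 2 * T)) t -
          planeWave (x t - v * t - 2 * T) q * oscInt m v (fun _ => 1) t) -
        (oscInt m v (planeWave (x t - v * t)) t -
          planeWave (x t - v * t) q * oscInt m v (fun _ => 1) t) := by
      rw [sub_eq_add_neg _ (2 * (T : ℝ)), planeWave_add]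
      ring
    rw [e]
    refine (norm_sub_le _ _).trans ((add_le_add h2 h1).trans (le_of_eq ?_))
    rw [Real.norm_of_nonneg (by positivity : (0 : ℝ) ≤ 1 / t)]
    ring
  refine (hmain.add (h.const_mul_left (π / m))).congr_left fun t => ?_
  ring

/-- A dip forces the amplitude to vanish at the stationary point. -/
theorem planeWave_eq_one_of_isDip {m v q : ℝ} (hm : 0 < m) (hv : |v| < 1)
    (hq : Real.sin q = v * density m q) (hq' : q ∈ Set.Ioo (-(π / 2)) (π / 2)) {T : ℕ}
    (h : ∀ x : ℕ → ℤ,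
      ((fun t : ℕ => (x t : ℝ) - v * (t : ℝ)) =o[atTop] fun t : ℕ => √(t : ℝ)) →
      ((fun t : ℕ => a₁ (x t : ℝ) (t : ℝ) m 1 - a₁ ((x t : ℝ) - 2 * (T : ℝ)) (t : ℝ) m 1)
        =o[atTop] fun t : ℕ => (√(t : ℝ))⁻¹)) :
    planeWave (-(2 * T)) q = 1 := by
  by_contra hne
  -- At `q = 0` the plane wave is trivially 1. Hence `sin 2q ≠ 0`, which makes the two rotations
  -- below independent.
  have hq0 : q ≠ 0 := by
    rintro rfl
    exact hne (by simp [planeWave])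
  have hsin : Real.sin (2 * q) ≠ 0 := by
    rw [Real.sin_two_mul]
    have h1 := (Real.cos_pos_of_mem_Ioo hq').ne'
    have h2 : Real.sin q ≠ 0 := fun h0 => hq0
      ((Real.sin_eq_zero_iff_of_lt_of_lt (by linarith [hq'.1, Real.pi_pos])
        (by linarith [hq'.2, Real.pi_pos])).1 h0)
    exact mul_ne_zero (mul_ne_zero two_ne_zero h2) h1
  set z : ℕ → ℂ := fun t => planeWave (oddPoint v t - v * t) q *
    ((1 - planeWave (-(2 * T)) q) * oscInt m v (fun _ => 1) t) with hz
  have hb0 := abs_oddPoint_sub_le v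
  have hb2 : ∀ t, |((oddPoint v t + 2 : ℤ) : ℝ) - v * t| ≤ 3 := fun t => by
    have := abs_le.1 (hb0 t)
    rw [abs_le]; push_cast; constructor <;> linarith [this.1, this.2]
  have him : (fun t => (z t).im) =o[atTop] fun t : ℕ => (√(t : ℝ))⁻¹ :=
    isLittleO_im_leading hm hv hq hq' hb0 (odd_oddPoint_add v)
      (h _ (isLittleO_sqrt_of_bounded hb0))
  -- Moving the point by 2 keeps the parity and rotates `z` by `e^{-2iq}`. The imaginary parts of
  -- `z` and of its rotation determine the real part, after division by `sin 2q`.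
  have him2 : (fun t => (planeWave 2 q * z t).im) =o[atTop] fun t : ℕ => (√(t : ℝ))⁻¹ := by
    refine (isLittleO_im_leading hm hv hq hq' hb2 (fun t => ?_)
      (h _ (isLittleO_sqrt_of_bounded hb2))).congr_left fun t => ?_
    · have : oddPoint v t + 2 + (t : ℤ) = (oddPoint v t + t) + 2 := by ring
      rw [this]
      exact (odd_oddPoint_add v t).add_even even_two
    · have : ((oddPoint v t + 2 : ℤ) : ℝ) - v * t = 2 + (oddPoint v t - v * t) := by
        push_cast; ring
      rw [this, planeWave_add, mul_assoc]
  have hre : (fun t => (z t).re) =o[atTop] fun t : ℕ => (√(t : ℝ))⁻¹ := by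
    refine (((him.const_mul_left (Real.cos (2 * q))).sub him2).const_mul_left
      (Real.sin (2 * q))⁻¹).congr_left fun t => ?_
    have hp : planeWave 2 q = Complex.exp ((-(2 * q) : ℝ) * Complex.I) := by
      rw [planeWave]; congr 1; push_cast; ring
    rw [hp, Complex.mul_im (Complex.exp _), Complex.exp_ofReal_mul_I_re, Complex.exp_ofReal_mul_I_im,
      Real.cos_neg, Real.sin_neg]
    field_simp
    ring
  have hzo : z =o[atTop] fun t : ℕ => (√(t : ℝ))⁻¹ := by
    refine IsBigO.trans_isLittleO (g := fun t => |(z t).re| + |(z t).im|) ?_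
      (hre.norm_left.add him.norm_left)
    refine IsBigO.of_bound 1 (Eventually.of_forall fun t => ?_)
    rw [one_mul, Real.norm_of_nonneg (by positivity)]
    exact Complex.norm_le_abs_re_add_abs_im _
  refine not_isLittleO_oscInt_one hm hv hq hq' (IsBigO.trans_isLittleO (g := z) ?_ hzo)
  have hκ : 0 < ‖1 - planeWave (-(2 * T)) q‖ := norm_pos_iff.2 (sub_ne_zero.2 (Ne.symm hne))
  refine IsBigO.of_bound ‖1 - planeWave (-(2 * T)) q‖⁻¹ (Eventually.of_forall fun t => ?_)
  rw [hz, norm_mul, norm_planeWave, one_mul, norm_mul, inv_mul_cancel_left₀ hκ.ne']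

/-! ### Stationary points and the list of dips -/

/-- Inside the admissible interval there is a stationary point. -/
theorem exists_stationary {m v : ℝ} (hm : 0 < m)
    (hv : v ∈ Set.Ioo (-(1 / √(1 + m ^ 2))) (1 / √(1 + m ^ 2))) :
    ∃ q ∈ Set.Ioo (-(π / 2)) (π / 2), Real.sin q = v * density m q := by
  have hN := sqrt_one_add_sq_pos m
  have hv2 : v ^ 2 * (1 + m ^ 2) < 1 := by
    have h1 : |v| < 1 / √(1 + m ^ 2) := abs_lt.2 hv
    rw [lt_div_iff₀ hN] at h1
    have h2 : (|v| * √(1 + m ^ 2)) ^ 2 < 1 := by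
      rw [sq_lt_one_iff_abs_lt_one, abs_of_nonneg (by positivity)]; exact h1
    rwa [mul_pow, sq_abs, Real.sq_sqrt (by positivity)] at h2
  have hpos : 0 < 1 - v ^ 2 := by nlinarith [mul_nonneg (sq_nonneg v) (sq_nonneg m)]
  have hs : 0 < √(1 - v ^ 2) := Real.sqrt_pos.2 hpos
  have hs2 : √(1 - v ^ 2) ^ 2 = 1 - v ^ 2 := Real.sq_sqrt hpos.le
  -- Squaring `sin q = v S(q)` gives `sin q = m v / √(1 - v²)`; this is a sine of an interior angle
  -- exactly because `v² (1 + m²) < 1`.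
  have hlt : |m * v / √(1 - v ^ 2)| < 1 := by
    rw [← sq_lt_one_iff_abs_lt_one, div_pow, hs2, div_lt_one hpos]
    nlinarith
  have hsin : Real.sin (Real.arcsin (m * v / √(1 - v ^ 2))) = m * v / √(1 - v ^ 2) :=
    Real.sin_arcsin (abs_lt.1 hlt).1.le (abs_lt.1 hlt).2.le
  refine ⟨Real.arcsin (m * v / √(1 - v ^ 2)), ⟨?_, ?_⟩, ?_⟩
  · exact Real.neg_pi_div_two_lt_arcsin.2 (abs_lt.1 hlt).1
  · exact Real.arcsin_lt_pi_div_two.2 (abs_lt.1 hlt).2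
  · have hd : density m (Real.arcsin (m * v / √(1 - v ^ 2))) = m / √(1 - v ^ 2) := by
      rw [density, hsin, Real.sqrt_eq_iff_mul_self_eq (by positivity) (by positivity)]
      field_simp
      rw [hs2]
      ring
    rw [hsin, hd]
    ring

theorem sin_div_density_mem {m q : ℝ} (hm : 0 < m) (hq : q ∈ Set.Ioo (-(π / 2)) (π / 2)) :
    Real.sin q / density m q ∈ Set.Ioo (-(1 / √(1 + m ^ 2))) (1 / √(1 + m ^ 2)) := by
  have hd := density_pos hm q
  have hN := sqrt_one_add_sq_pos m
  have hc := Real.cos_pos_of_mem_Ioo hq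
  have hs : Real.sin q ^ 2 < 1 := by nlinarith [Real.sin_sq_add_cos_sq q]
  rw [Set.mem_Ioo, ← abs_lt, abs_div, abs_of_pos hd, div_lt_div_iff₀ hd hN, one_mul]
  refine lt_of_pow_lt_pow_left₀ 2 hd.le ?_
  rw [mul_pow, sq_abs, Real.sq_sqrt (by positivity), density_sq]
  nlinarith [pow_pos hm 2]

theorem planeWave_eq_one_iff {T : ℕ} (hT : 0 < T) (q : ℝ) :
    planeWave (-(2 * T)) q = 1 ↔ ∃ k : ℤ, q = π * k / T := by
  have hT' : (T : ℝ) ≠ 0 := by exact_mod_cast hT.ne'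
  rw [planeWave, Complex.exp_eq_one_iff]
  refine exists_congr fun k => ?_
  have h1 : Complex.I * ((-(q * -(2 * T)) : ℝ) : ℂ) = ((2 * q * T : ℝ) : ℂ) * Complex.I := by
    push_cast; ring
  have h2 : (k : ℂ) * (2 * π * Complex.I) = ((2 * (π * k) : ℝ) : ℂ) * Complex.I := by
    push_cast; ring
  rw [h1, h2, mul_left_inj' Complex.I_ne_zero, Complex.ofReal_inj, eq_div_iff hT']
  constructor <;> intro h <;> linarith

theorem abs_lt_one_of_mem {m v : ℝ} (hm : 0 < m)
    (hv : v ∈ Set.Ioo (-(1 / √(1 + m ^ 2))) (1 / √(1 + m ^ 2))) : |v| < 1 := by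
  refine (abs_lt.2 hv).trans ?_
  rw [div_lt_one (sqrt_one_add_sq_pos m)]
  exact one_lt_sqrt_one_add_sq hm

theorem isDipUnit_iff {m : ℝ} (hm : 0 < m) {T : ℕ} (hT : 0 < T) (v : ℝ) :
    IsDipUnit (1 / 2) (-1 / 2) m T v ↔
      ∃ k : ℤ, π * k / T ∈ Set.Ioo (-(π / 2)) (π / 2) ∧
        v = Real.sin (π * k / T) / density m (π * k / T) := by
  rw [IsDipUnit, rpow_half_eq, rpow_neg_half_eq]
  constructor
  · rintro ⟨hv, h⟩
    obtain ⟨q, hq', hq⟩ := exists_stationary hm hv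
    obtain ⟨k, rfl⟩ := (planeWave_eq_one_iff hT q).1
      (planeWave_eq_one_of_isDip hm (abs_lt_one_of_mem hm hv) hq hq' h)
    exact ⟨k, hq', by rw [hq, mul_div_cancel_right₀ _ (density_pos hm _).ne']⟩
  · rintro ⟨k, hk, rfl⟩
    have hv := sin_div_density_mem hm hk
    refine ⟨hv, fun x hx => ?_⟩
    exact isLittleO_of_planeWave_eq_one hm (abs_lt_one_of_mem hm hv)
      (div_mul_cancel₀ _ (density_pos hm _).ne').symm hk
      ((planeWave_eq_one_iff hT _).2 ⟨k, rfl⟩) hx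

end FeynmanCheckers

theorem theorem5 (m ε : ℝ) (hm : 0 < m) (hε : 0 < ε) (hεm : ε ≤ 1 / m) (T : ℕ) (hT : 0 < T) :
    {v : ℝ | FeynmanCheckers.IsDip (1 / 2) (-1 / 2) m ε T v} =
      {v : ℝ | ∃ k : ℤ, -((T : ℝ) / 2) < (k : ℝ) ∧ (k : ℝ) < (T : ℝ) / 2 ∧
        v = Real.sin (Real.pi * (k : ℝ) / (T : ℝ)) /
          √(m ^ 2 * ε ^ 2 + Real.sin (Real.pi * (k : ℝ) / (T : ℝ)) ^ 2)} := by
  ext v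
  rw [Set.mem_ofPred_eq, Set.mem_ofPred_eq, FeynmanCheckers.IsDip,
    FeynmanCheckers.isDipUnit_iff (mul_pos hm hε) hT]
  refine exists_congr fun k => ?_
  have hT' : (0 : ℝ) < T := by exact_mod_cast hT
  have hpi := Real.pi_pos
  rw [FeynmanCheckers.density, mul_pow, Set.mem_Ioo, and_assoc, lt_div_iff₀ hT', div_lt_iff₀ hT']
  have h1 : -(Real.pi / 2) * T < Real.pi * k ↔ -((T : ℝ) / 2) < k := by
    rw [show -(Real.pi / 2) * T = Real.pi * (-((T : ℝ) / 2)) by ring, mul_lt_mul_iff_right₀ hpi]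
  have h2 : Real.pi * k < Real.pi / 2 * T ↔ (k : ℝ) < (T : ℝ) / 2 := by
    rw [show Real.pi / 2 * T = Real.pi * ((T : ℝ) / 2) by ring, mul_lt_mul_iff_right₀ hpi]
  rw [h1, h2]
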